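/- **Setting.** Let $N\ge 1$ and let $T\in\mathbb R^{I_1\times\dots\times I_N}$ be $T=\llbracket G_*;A_*^{(1)},\dots,A_*^{(N)}\rrbracket$, where the $A_*^{(n)}\in\mathbb R^{I_n\times r_n}$ have orthonormal columns and the core $G_*\in\mathbb R^{r_1\times\dots\times r_N}$ is represented by a tensor network with a given weighted diagram $\mathtt G^+$ and has multilinear rank $(r_1,\dots,r_N)$ (A2). Here $X_{(n)}$ is the mode-$n$ unfolding and $\Pi_\Omega$ sets the entries outside $\Omega$ to zero. Every index belongs to the random set $\Omega$ independently with probability $p$ (A1). **Algorithm (two-level ALS).** Start from factors $A_0^{(n)}$ with orthonormal columns and node tensors $\mathscr B_0$; let $G_t$ be the core represented by $\mathscr B_t$. Step $t$: for $n=1,\dots,N$ choose a minimizer $X$ of $\|\Pi_\Omega(\llbracket G_{t-1};Q_t^{(1)},\dots,Q_t^{(n-1)},X,A_{t-1}^{(n+1)},\dots,A_{t-1}^{(N)}\rrbracket-T)\|_F$ and an economic QR decomposition $X=Q_t^{(n)}R_t^{(n)}$, and multiply the $R_t^{(n)}$ into the outgoing modes of the node tensors. Then update the node tensors by the ALS method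 for $\|\Pi_\Omega(\llbracket G;Q_t^{(1)},\dots,Q_t^{(N)}\rrbracket-T)\|_F$ (least squares in one node tensor at a time, in an order in which every node recurs infinitely often), stopped after finitely many updates or continued to the limit of the cores. Finally, for each $n$ compute an SVD of the mode-$n$ unfolding of the resulting core, let $r_t^{(n)}$ be the number of its singular values with $\sigma_1\le\kappa_n\sigma_j$ ($\kappa_n\ge1$ prescribed) and $U_t^{(n)}$ the corresponding left singular vectors, put $A_t^{(n)}=Q_t^{(n)}U_t^{(n)}$, and multiply the $(U_t^{(n)})^{\rm T}$ into the node tensors, which gives $\mathscr B_t$. Initially $r_0^{(n)}\ge{\rm rank}\,T_{(n)}$. The iteration is continued for all $t\ge1$. A *run* is any sequence so obtained, with any initialization (it may depend on $\Omega$) and any choices of minimizers, decompositions and node orders. **Notation.** $J_n=\prod_{k\ne n}I_k$, $J_{\min}=\min_nJ_n$, $g_{\max}=\max_k\|T_{(k)}\|$, $\kappa=\max_k\sigma_1([G_*]_{(k)})/\sigma_{\min}([G_*]_{(k)})$, $\sin\theta_t=\max_k\|\sin\Theta(A_t^{(k)},A_*^{(k)})\|$, $\tau_t=\|\Pi_\Omega(\llbracket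 G_t;A_t^{(1)},\dots,A_t^{(N)}\rrbracket-T)\|_F$, $$p_*=\tfrac{10}{3}\Big(\log\big(2\textstyle\prod_kI_k\big)+5\Big)\max_n\prod_{k\ne n}\frac{\mu_kr_k}{I_k},$$ $$M_{t,n}=A_{t-1}^{(N)}\otimes\dots\otimes A_{t-1}^{(n+1)}\otimes Q_t^{(n-1)}\otimes\dots\otimes Q_t^{(1)},\qquad M_{*,n}=A_*^{(N)}\otimes\dots\otimes A_*^{(n+1)}\otimes A_*^{(n-1)}\otimes\dots\otimes A_*^{(1)}.$$ Let $\psi_0=\|\llbracket\widetilde X_0;A_0^{(1)},\dots,A_0^{(N)}\rrbracket-T\|_F$, where $\widetilde X_0$ is any minimizer of $X\mapsto\|\Pi_\Omega(\llbracket X;A_0^{(1)},\dots,A_0^{(N)}\rrbracket-T)\|_F$. **Hypotheses on the constants.** Fix real $\mu_1,\dots,\mu_N$, $0<\gamma\le\Gamma$, $g_{\min}>0$, $C>0$, $\alpha\ge1$ and $p\in[4p_*,\tfrac12]$, and assume $\sigma_{\min}([G_*]_{(n)})\ge g_{\min}$ for all $n$. Put $$C_1=C\frac{g_{\max}}{g_{\min}}\max_n\Big\{\sqrt{\tfrac{7\mu_nr_n}{I_n}}\prod_{k\ne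 n}\sqrt{\mu_kr_k}\Big\},\quad C_2=C\max_n\sqrt{\tfrac{\mu_nr_nJ_n}{I_n}},\quad \eta=6g_{\max}(C_1+C_2)\sqrt{\tfrac{\alpha}{p}}.$$ **Hypotheses on a run.** (A3) $\|A_t^{(n)}\|_{2,\infty}\le\sqrt{\mu_nr_n/I_n}$ for all $n$ and $t\ge0$; (A4) $\gamma\,\tau_t\le\min_X\|\Pi_\Omega(\llbracket X;A_t^{(1)},\dots,A_t^{(N)}\rrbracket-T)\|_F\le\Gamma\,\tau_t$ for all $t\ge0$; (A5) $r_t^{(n)}=r_n$ for all $n$ and $t\ge0$; $\sigma_{\min}([G_t]_{(n)})\ge g_{\min}$ for all $n$ and $t\ge0$; $\|\sin\Theta(M_{t,n}[G_{t-1}]_{(n)}^{\rm T},M_{*,n}[G_*]_{(n)}^{\rm T})\|\le C\sin\theta_{t-1}$ for all $n$ and $t\ge1$; $g_{\min}-\sqrt2\,\kappa\psi_0-\eta\sin\theta_0>0$ and $$\mu:=\frac{3}{\sqrt2}\,\frac{\|T\|_F}{g_{\min}}\,\frac{(1+\sin\theta_0)^N-1}{\sin\theta_0}\cdot\frac{\eta}{g_{\min}-\sqrt2\,\kappa\psi_0-\eta\sin\theta_0}<\frac{\gamma}{7\Gamma}$$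 (the third factor is read as its limit $N$ if $\sin\theta_0=0$). **Theorem.** With probability at least $1-\frac{1}{100\,J_{\min}}$ over $\Omega$, every run that satisfies these hypotheses satisfies, for all $t\ge1$ simultaneously, $$\|\llbracket G_t;A_t^{(1)},\dots,A_t^{(N)}\rrbracket-T\|_F\le\frac{7\mu\Gamma}{\gamma}\,\|\llbracket G_{t-1};A_{t-1}^{(1)},\dots,A_{t-1}^{(N)}\rrbracket-T\|_F,$$ and $\llbracket G_t;A_t^{(1)},\dots,A_t^{(N)}\rrbracket\to T$ as $t\to\infty$; that is, the algorithm converges to the exact completion at a linear rate. -/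

import Mathlib

open scoped Matrix

noncomputable section

namespace TensorCompletion

/-! ### Tensors, unfoldings, modal products -/

/-- The index set of a tensor of size `d 0 × ⋯ × d (N - 1)`. -/
abbrev Index {N : ℕ} (d : Fin N → ℕ) : Type := ∀ n, Fin (d n)

/-- Real tensors of order `N` and size `d 0 × ⋯ × d (N - 1)`. -/
abbrev Tensor {N : ℕ} (d : Fin N → ℕ) : Type := Index d → ℝ

/-- Frobenius norm of a finite array. -/
def fro {ι : Type*} [Fintype ι] (X : ι → ℝ) : ℝ := √(∑ i, X i ^ 2)

/-- `Π_Ω`: keep the entries in `Ω`, replace the other ones by zero. -/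
def mask {ι : Type*} (Ω : Set ι) (X : ι → ℝ) : ι → ℝ := Ω.indicator X

/-- The mode-`n` unfolding: rows are indexed by the mode-`n` index, columns by all the others
(the columns are the mode-`n` fibers). -/
def unfold {N : ℕ} {d : Fin N → ℕ} (n : Fin N) (X : Tensor d) :
    Matrix (Fin (d n)) (∀ k : {k : Fin N // k ≠ n}, Fin (d k)) ℝ :=
  fun a c => X fun k => if h : k = n then Fin.cast (by rw [h]) a else c ⟨k, h⟩

/-- `⟦X; A 0, …, A (N - 1)⟧ = X ×₁ A 0 ⋯ ×_N A (N - 1)`. -/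
def tucker {N : ℕ} {d e : Fin N → ℕ} (X : Tensor d)
    (A : ∀ n, Matrix (Fin (e n)) (Fin (d n)) ℝ) : Tensor e :=
  fun i => ∑ j : Index d, (∏ n, A n (i n) (j n)) * X j

/-- The Kronecker product of the matrices `A k`, `k ≠ n`, with rows and columns indexed in the same
way as the columns of `unfold n`. -/
def kronExcept {N : ℕ} {d e : Fin N → ℕ} (n : Fin N)
    (A : ∀ k, Matrix (Fin (e k)) (Fin (d k)) ℝ) :
    Matrix (∀ k : {k : Fin N // k ≠ n}, Fin (e k)) (∀ k : {k : Fin N // k ≠ n}, Fin (d k)) ℝ :=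
  fun i j => ∏ k : {k : Fin N // k ≠ n}, A k (i k) (j k)

/-! ### Singular values, spectral norm, canonical angles -/

section MatrixNotions

variable {m n l : Type*} [Fintype m] [Fintype n] [Fintype l]
  [DecidableEq m] [DecidableEq n] [DecidableEq l]

/-- The spectral norm. -/
def specNorm (A : Matrix m n ℝ) : ℝ :=
  ‖LinearMap.toContinuousLinearMap (Matrix.toEuclideanLin A)‖

/-- The singular values in descending order, `sing A 0` being the largest one. -/
def sing (A : Matrix m n ℝ) (j : ℕ) : ℝ := (Matrix.toEuclideanLin A).singularValues j

/-- The smallest of the `min {m, n}` singular values of an `m × n` matrix. -/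
def singMin (A : Matrix m n ℝ) : ℝ := sing A (min (Fintype.card m) (Fintype.card n) - 1)

/-- The spectral condition number. -/
def condNumber (A : Matrix m n ℝ) : ℝ := sing A 0 / singMin A

/-- The range space of a matrix. -/
def colSpace (A : Matrix m n ℝ) : Submodule ℝ (EuclideanSpace ℝ m) :=
  LinearMap.range (Matrix.toEuclideanLin A)

/-- `‖sin Θ(X, Y)‖`: for range spaces of the same dimension, the norm of the difference of the
orthogonal projections onto them is the sine of their largest canonical angle. -/
def sinTheta (X : Matrix m n ℝ) (Y : Matrix m l ℝ) : ℝ :=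
  ‖(colSpace X).starProjection - (colSpace Y).starProjection‖

end MatrixNotions

/-! ### Tensor networks -/

/-- A tensor diagram with `K` nodes, `M` weighted edges and `N` outgoing edges; the outgoing edge
`n` belongs to the node `owner n`. An edge is given by the set of its end nodes (two nodes for an
edge of a graph; a larger set is a contraction through a diagonal tensor, as in the CP format). -/
structure Diagram (N K M : ℕ) where
  ends : Fin M → Finset (Fin K)
  weight : Fin M → ℕ
  owner : Fin N → Fin K

namespace Diagram

variable {N K M : ℕ} (D : Diagram N K M)

/-- Collections of node tensors. The tensor at node `v` has one mode for every edge at `v` and one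
mode for every outgoing edge at `v`; `d` is the vector of weights of the outgoing edges. -/
abbrev Nodes (d : Fin N → ℕ) : Type :=
  ∀ v : Fin K, (∀ e : {e : Fin M // v ∈ D.ends e}, Fin (D.weight e)) →
    (∀ n : {n : Fin N // D.owner n = v}, Fin (d n)) → ℝ

/-- The tensor represented by the network: contract all edges. -/
def contract {d : Fin N → ℕ} (B : D.Nodes d) : Tensor d :=
  fun i => ∑ s : (∀ e : Fin M, Fin (D.weight e)), ∏ v, B v (fun e => s e) (fun n => i n)

/-- Multiply the node tensors by the matrices `R n` along their outgoing modes. -/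
def absorb {d d' : Fin N → ℕ} (R : ∀ n, Matrix (Fin (d' n)) (Fin (d n)) ℝ) (B : D.Nodes d) :
    D.Nodes d' :=
  fun v s i => ∑ j : (∀ n : {n : Fin N // D.owner n = v}, Fin (d n)),
    (∏ n : {n : Fin N // D.owner n = v}, R n (i n) (j n)) * B v s j

end Diagram

/-! ### The two-level alternating least squares algorithm -/

section Algorithm

variable {N K M : ℕ} {I : Fin N → ℕ}

/-- The observed residual `‖Π_Ω(⟦G; A⟧ - T)‖_F`. -/
def obsResidual (Ω : Set (Index I)) (T : Tensor I) {d : Fin N → ℕ} (G : Tensor d)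
    (A : ∀ n, Matrix (Fin (I n)) (Fin (d n)) ℝ) : ℝ :=
  fro (mask Ω (tucker G A - T))

/-- The smallest observed residual over all cores of the given size. -/
def minObsResidual (Ω : Set (Index I)) (T : Tensor I) {d : Fin N → ℕ}
    (A : ∀ n, Matrix (Fin (I n)) (Fin (d n)) ℝ) : ℝ :=
  ⨅ X : Tensor d, obsResidual Ω T X A

/-- `B'` arises from `B` by a least squares update of the node tensor at `v`, with all the other
node tensors and the factor matrices `A` fixed. -/
def IsNodeUpdate (D : Diagram N K M) (Ω : Set (Index I)) (T : Tensor I) {d : Fin N → ℕ}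
    (A : ∀ n, Matrix (Fin (I n)) (Fin (d n)) ℝ) (v : Fin K) (B B' : D.Nodes d) : Prop :=
  (∀ u, u ≠ v → B' u = B u) ∧
    ∀ B'' : D.Nodes d, (∀ u, u ≠ v → B'' u = B u) →
      obsResidual Ω T (D.contract B') A ≤ obsResidual Ω T (D.contract B'') A

/-- `B'` is a result of the second level, the ALS method for the node tensors started at `B`: the
nodes are updated one after the other, every node again and again, until the core tensor
has converged. The iteration may be stopped after finitely many updates or continued to the limit of
the core tensors. As node tensors are determined only up to the natural indeterminacies of a
network (such as normalizations), the core tensors are compared. -/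
def IsALSResult (D : Diagram N K M) (Ω : Set (Index I)) (T : Tensor I) {d : Fin N → ℕ}
    (A : ∀ n, Matrix (Fin (I n)) (Fin (d n)) ℝ) (B B' : D.Nodes d) : Prop :=
  ∃ (order : ℕ → Fin K) (seq : ℕ → D.Nodes d),
    (∀ v, ∃ᶠ j in Filter.atTop, order j = v) ∧
    seq 0 = B ∧
    (∀ j, IsNodeUpdate D Ω T A (order j) (seq j) (seq (j + 1))) ∧
    ((∃ j, D.contract B' = D.contract (seq j)) ∨
      Filter.Tendsto (fun j => D.contract (seq j)) Filter.atTop (nhds (D.contract B')))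

/-- `U` consists of the leading left singular vectors of `G`, one for every singular value
`σ_j` with `σ_1 ≤ κ σ_j`. -/
def IsTruncatedLeftSingular {a b : ℕ} {c : Type*} [Fintype c] [DecidableEq c] (κ : ℝ)
    (G : Matrix (Fin a) c ℝ) (U : Matrix (Fin a) (Fin b) ℝ) : Prop :=
  b = (Finset.univ.filter fun j : Fin a => sing G 0 ≤ κ * sing G j).card ∧
    ∃ V : Matrix (Fin a) (Fin a) ℝ, Vᵀ * V = 1 ∧
      G * Gᵀ * V = V * Matrix.diagonal (fun j : Fin a => sing G j ^ 2) ∧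
      ∃ h : b ≤ a, U = V.submatrix id (Fin.castLE h)

/-- The factor matrices in force in a sweep when the factor `n` is updated: the new factors
`Q k` for `k < n`, the old factors `A k` for `k ≥ n`. -/
def sweep {d : Fin N → ℕ} (Q A : ∀ k, Matrix (Fin (I k)) (Fin (d k)) ℝ) (n : Fin N) :
    ∀ k, Matrix (Fin (I k)) (Fin (d k)) ℝ :=
  fun k => if k < n then Q k else A k

/-- A sequence of iterates of the two-level ALS method for the data `Π_Ω(T)`, the diagram `D` and
the condition number bounds `κ`. The index `t` of `Q`, `R`, `U`, `Bmid` refers to the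
step from iterate `t` to iterate `t + 1`. All solutions of the least squares problems, all economic
QR decompositions and all singular value decompositions are allowed, and so is any
initialization with orthonormal factors. -/
structure Run (D : Diagram N K M) (Ω : Set (Index I)) (T : Tensor I) (κ : Fin N → ℝ) where
  /-- the estimates of the multilinear rank -/
  rk : ℕ → Fin N → ℕ
  /-- the factor matrices -/
  A : ∀ t n, Matrix (Fin (I n)) (Fin (rk t n)) ℝ
  /-- the node tensors -/
  B : ∀ t, D.Nodes (rk t)
  /-- the orthonormal factors computed by the first level, before the rank reduction -/
  Q : ∀ t n, Matrix (Fin (I n)) (Fin (rk t n)) ℝ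
  /-- the triangular factors -/
  R : ∀ t n, Matrix (Fin (rk t n)) (Fin (rk t n)) ℝ
  /-- the node tensors computed by the second level, before the rank reduction -/
  Bmid : ∀ t, D.Nodes (rk t)
  /-- the matrices of the rank reduction -/
  U : ∀ t n, Matrix (Fin (rk t n)) (Fin (rk (t + 1) n)) ℝ
  rank_le : ∀ n, (unfold n T).rank ≤ rk 0 n
  orthonormal_init : ∀ n, (A 0 n)ᵀ * A 0 n = 1
  /-- the least squares update of the factor `n` and its QR decomposition -/
  factor_update : ∀ t n, ∃ X : Matrix (Fin (I n)) (Fin (rk t n)) ℝ,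
    (∀ Y : Matrix (Fin (I n)) (Fin (rk t n)) ℝ,
      obsResidual Ω T (D.contract (B t)) (Function.update (sweep (Q t) (A t) n) n X) ≤
        obsResidual Ω T (D.contract (B t)) (Function.update (sweep (Q t) (A t) n) n Y)) ∧
    X = Q t n * R t n ∧ (Q t n)ᵀ * Q t n = 1 ∧ ∀ i j, j < i → R t n i j = 0
  node_update : ∀ t, IsALSResult D Ω T (Q t) (D.absorb (R t) (B t)) (Bmid t)
  truncation : ∀ t n, IsTruncatedLeftSingular (κ n) (unfold n (D.contract (Bmid t))) (U t n)
  factor_succ : ∀ t n, A (t + 1) n = Q t n * U t n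
  node_succ : ∀ t, B (t + 1) = D.absorb (fun n => (U t n)ᵀ) (Bmid t)

namespace Run

variable {D : Diagram N K M} {Ω : Set (Index I)} {T : Tensor I} {κ : Fin N → ℝ}

/-- The core tensor `G_t`. -/
def core (run : Run D Ω T κ) (t : ℕ) : Tensor (run.rk t) := D.contract (run.B t)

/-- The estimate `⟦G_t; A_t⟧` of `T`. -/
def estimate (run : Run D Ω T κ) (t : ℕ) : Tensor I := tucker (run.core t) (run.A t)

/-- The full residual `‖⟦G_t; A_t⟧ - T‖_F`. -/
def residual (run : Run D Ω T κ) (t : ℕ) : ℝ := fro (run.estimate t - T)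

/-- The observed residual `τ_t`. -/
def tau (run : Run D Ω T κ) (t : ℕ) : ℝ := obsResidual Ω T (run.core t) (run.A t)

/-- `sin θ_t = max_k ‖sin Θ(A_t^{(k)}, A_*^{(k)})‖`. -/
def sinAngle (run : Run D Ω T κ) {r : Fin N → ℕ}
    (Astar : ∀ n, Matrix (Fin (I n)) (Fin (r n)) ℝ) (t : ℕ) : ℝ :=
  ⨆ k, sinTheta (run.A t k) (Astar k)

end Run

end Algorithm

/-! ### The constants -/

section Constants

variable {N : ℕ} (I r : Fin N → ℕ) (μ : Fin N → ℝ)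

/-- `J_n = ∏_{k ≠ n} I_k`. -/
def coDim (n : Fin N) : ℝ := ∏ k ∈ Finset.univ.erase n, (I k : ℝ)

/-- `J_min`. -/
def coDimMin : ℝ := ⨅ n, coDim I n

/-- The sampling threshold `p_*`. -/
def pStar : ℝ :=
  10 / 3 * (Real.log (2 * ∏ k, (I k : ℝ)) + 5) *
    ⨆ n, ∏ k ∈ Finset.univ.erase n, μ k * r k / I k

/-- `g_max = max_k ‖T_(k)‖`. -/
def gMax (T : Tensor I) : ℝ := ⨆ k, specNorm (unfold k T)

/-- `C_1`. -/
def const1 (C gmax gmin : ℝ) : ℝ :=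
  C * (gmax / gmin) * ⨆ n, √(7 * μ n * r n / I n) * ∏ k ∈ Finset.univ.erase n, √(μ k * r k)

/-- `C_2`. -/
def const2 (C : ℝ) : ℝ := C * ⨆ n, √(μ n * r n * coDim I n / I n)

/-- `6 g_max (C_1 + C_2) √(α / p)`. -/
def sampleError (C gmax gmin α p : ℝ) : ℝ :=
  6 * gmax * (const1 I r μ C gmax gmin + const2 I r μ C) * √(α / p)

/-- `((1 + s)^N - 1) / s`, with its limit `N` as the value at `s = 0`. -/
def growth (N : ℕ) (s : ℝ) : ℝ := ∑ j ∈ Finset.range N, (1 + s) ^ j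

theorem growth_eq (N : ℕ) {s : ℝ} (hs : s ≠ 0) : growth N s = ((1 + s) ^ N - 1) / s := by
  have h : (1 + s) ≠ 1 := by simpa using hs
  rw [growth, geom_sum_eq h]
  simp

/-- The denominator `g_min - √2 κ ψ_0 - η sin θ_0` of the contraction quantity. -/
def contractionDenom (gmin κ ψ η s : ℝ) : ℝ := gmin - √2 * κ * ψ - η * s

/-- The contraction quantity, for `a = ‖T‖_F`, `s = sin θ_0`, `ψ = ψ_0` and
`η = 6 g_max (C_1 + C_2) √(α / p)`. -/
def contractionQuantity (N : ℕ) (a gmin κ ψ η s : ℝ) : ℝ :=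
  3 / √2 * (a / gmin) * growth N s * (η / contractionDenom gmin κ ψ η s)

end Constants

end TensorCompletion

end

open TensorCompletion

open scoped Matrix

noncomputable section

namespace TensorCompletion

/-! ### The Frobenius norm -/

/-! Write `s_t` for the sine of the largest canonical angle at step `t`, `a = ‖T‖_F`, `g = g_min`
and `q = C a / g`. The bound on the contraction quantity `m` is so strong that it forces `12 N (a/g)
q ≤ m √p` (`sampleError_ge`, `contractionQuantity_ge`), hence `q` is small compared with `√p`.
Everything else follows from the smallness of `q`.

Angles. If the spaces spanned by the unfoldings along mode `n` are `ε`-close, projecting the rows of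
`T_(n)` yields a Tucker tensor that keeps the approximate factors in the modes `k ≠ n` and lies
within `ε a` of `T`. Since `g` bounds the singular values of the true core from below, those factors
are within `ε a / g` of the true ones (`mul_sinTheta_le_of_kronExcept`). The angle hypothesis for
the first mode, where no factor has been replaced yet, therefore says that all the other factors are
within `q s_t` of the truth. For the second mode it says that the new first factor is within `q
s_t`. Together, `s_{t+1} ≤ max (q s_t) (q s_{t+1})`, so `s_{t+1} ≤ q s_t` (`Run.sinAngle_succ_le`).

Sampling. In all modes but the first, the iterates stay within `q` of the truth, so a single fixed
space serves all runs and all `t`: the range of the projection that acts by fixed factors `A'` in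
these modes and trivially in the first. The true factors are not known to be incoherent, so `A'` is
the initial factor tuple of some admissible run for some `Ω`. If there is none, the claim is void.
The choice does not depend on the random set, and no union over iterates is needed. A matrix
Chernoff bound shows that the sampling is well conditioned on this space with the required
probability (`setBernoulli_wellSampled_ge`, `failure_probability_le`). It rests on the rank-one case
of Lieb's theorem, which reduces to Chebyshev's sum inequality for spectral moments
(`moment_mul_moment_le`, `expTrace_rankOne_le`).

Conclusion. By perturbation, observed and full residuals agree up to the factor `√p` and absolute
constants (`sampled_residual_bounds`). Every core gives a residual of at least `g s_t`, and the
projection of `T` gives at most `N s_t a`. With the capacity assumption this turns the contraction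
of `s_t` into one of the residual (`Run.linear_convergence`). -/

theorem mask_add {ι : Type*} (Ω : Set ι) (X Y : ι → ℝ) : mask Ω (X + Y) = mask Ω X + mask Ω Y :=
  Set.indicator_add' _ _ _

section Fro

variable {ι κ : Type*} [Fintype ι] [Fintype κ]

theorem fro_eq_norm (X : ι → ℝ) : fro X = ‖WithLp.toLp 2 X‖ := by
  simp [fro, EuclideanSpace.norm_eq]

theorem fro_ofLp (x : EuclideanSpace ℝ ι) : fro (WithLp.ofLp x) = ‖x‖ := by
  rw [fro_eq_norm]

theorem fro_nonneg (X : ι → ℝ) : 0 ≤ fro X := Real.sqrt_nonneg _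

theorem sq_fro (X : ι → ℝ) : fro X ^ 2 = ∑ i, X i ^ 2 :=
  Real.sq_sqrt (Finset.sum_nonneg fun _ _ => sq_nonneg _)

theorem fro_le_iff {X : ι → ℝ} {c : ℝ} (hc : 0 ≤ c) : fro X ≤ c ↔ ∑ i, X i ^ 2 ≤ c ^ 2 := by
  rw [← sq_fro, sq_le_sq₀ (fro_nonneg _) hc]

theorem fro_zero : fro (0 : ι → ℝ) = 0 := by simp [fro]

theorem fro_add_le (X Y : ι → ℝ) : fro (X + Y) ≤ fro X + fro Y := by
  simp only [fro_eq_norm, WithLp.toLp_add]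
  exact norm_add_le _ _

theorem fro_sub_le (X Y : ι → ℝ) : fro (X - Y) ≤ fro X + fro Y := by
  simp only [fro_eq_norm, WithLp.toLp_sub]
  exact norm_sub_le _ _

theorem fro_sub_rev (X Y : ι → ℝ) : fro (X - Y) = fro (Y - X) := by
  simp only [fro_eq_norm, WithLp.toLp_sub]
  exact norm_sub_rev _ _

theorem fro_mask_le (Ω : Set ι) (X : ι → ℝ) : fro (mask Ω X) ≤ fro X := by
  classical
  refine Real.sqrt_le_sqrt (Finset.sum_le_sum fun i _ => ?_)
  rw [mask, Set.indicator_apply]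
  split_ifs
  · rfl
  · simpa using sq_nonneg (X i)

theorem sq_fro_eq_dotProduct (X : ι → ℝ) : fro X ^ 2 = X ⬝ᵥ X := by
  rw [sq_fro, dotProduct]
  exact Finset.sum_congr rfl fun _ _ => sq _

theorem abs_dotProduct_le (X Y : ι → ℝ) : |X ⬝ᵥ Y| ≤ fro X * fro Y := by
  have h := abs_real_inner_le_norm (WithLp.toLp 2 X) (WithLp.toLp 2 Y)
  rw [EuclideanSpace.inner_toLp_toLp] at h
  simpa [fro_eq_norm, dotProduct_comm] using h

theorem fro_vecMul_le (z : ι → ℝ) (U : Matrix ι κ ℝ) :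
    fro (z ᵥ* U) ≤ fro z * √(∑ a, ∑ c, U a c ^ 2) := by
  have h0 : 0 ≤ ∑ a, ∑ c, U a c ^ 2 :=
    Finset.sum_nonneg fun _ _ => Finset.sum_nonneg fun _ _ => sq_nonneg _
  have h1 : (fro z * √(∑ a, ∑ c, U a c ^ 2)) ^ 2 = ∑ c, (∑ a, z a ^ 2) * ∑ a, U a c ^ 2 := by
    rw [mul_pow, sq_fro, Real.sq_sqrt h0, ← Finset.mul_sum]
    congr 1
    exact Finset.sum_comm
  rw [fro_le_iff (mul_nonneg (fro_nonneg _) (Real.sqrt_nonneg _)), h1]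
  refine Finset.sum_le_sum fun c _ => ?_
  exact Finset.sum_mul_sq_le_sq_mul_sq _ _ _

theorem fro_mulVec_of_orthonormal [DecidableEq κ] {A : Matrix ι κ ℝ} (hA : Aᵀ * A = 1)
    (x : κ → ℝ) : fro (A *ᵥ x) = fro x := by
  have h : fro (A *ᵥ x) ^ 2 = fro x ^ 2 := by
    rw [sq_fro_eq_dotProduct, sq_fro_eq_dotProduct, Matrix.dotProduct_mulVec, Matrix.vecMul_mulVec,
      ← Matrix.mulVec_transpose, Matrix.transpose_mul, Matrix.transpose_transpose, hA,
      Matrix.one_mulVec]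
  exact (sq_eq_sq₀ (fro_nonneg _) (fro_nonneg _)).1 h

/-- A symmetric idempotent matrix does not increase the norm. -/
theorem fro_mulVec_le_of_proj {P : Matrix ι ι ℝ} (hs : Pᵀ = P) (hi : P * P = P) (x : ι → ℝ) :
    fro (P *ᵥ x) ≤ fro x := by
  have h : fro (P *ᵥ x) ^ 2 ≤ fro x * fro (P *ᵥ x) := by
    rw [sq_fro_eq_dotProduct, Matrix.dotProduct_mulVec, Matrix.vecMul_mulVec, hs, hi,
      ← Matrix.mulVec_transpose, hs, dotProduct_comm]
    exact (le_abs_self _).trans (abs_dotProduct_le _ _)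
  rcases (fro_nonneg (P *ᵥ x)).eq_or_lt with h0 | h0
  · rw [← h0]; exact fro_nonneg _
  · exact le_of_mul_le_mul_right (by rwa [sq] at h) h0

end Fro

/-! ### Multilinear algebra of modal products -/

section Tucker

variable {N : ℕ} {d e f : Fin N → ℕ}

theorem tucker_tucker (X : Tensor d) (A : ∀ n, Matrix (Fin (e n)) (Fin (d n)) ℝ)
    (B : ∀ n, Matrix (Fin (f n)) (Fin (e n)) ℝ) :
    tucker (tucker X A) B = tucker X fun n => B n * A n := by
  funext i
  simp only [tucker, Finset.mul_sum]
  rw [Finset.sum_comm]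
  refine Finset.sum_congr rfl fun l _ => ?_
  simp only [Matrix.mul_apply]
  rw [Fintype.prod_sum, Finset.sum_mul]
  refine Finset.sum_congr rfl fun j _ => ?_
  rw [Finset.prod_mul_distrib, mul_assoc]

theorem prod_one_apply {α : Type*} [Fintype α] {β : α → Type*} [∀ a, DecidableEq (β a)]
    [DecidableEq (∀ a, β a)] (i j : ∀ a, β a) :
    ∏ a, (1 : Matrix (β a) (β a) ℝ) (i a) (j a) = if i = j then 1 else 0 := by
  split_ifs with h
  · subst h; simp
  · obtain ⟨a, ha⟩ := Function.ne_iff.1 h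
    exact Finset.prod_eq_zero (Finset.mem_univ a) (Matrix.one_apply_ne ha)

theorem tucker_one (X : Tensor d) : tucker X (fun _ => 1) = X := by
  classical
  funext i
  simp [tucker, prod_one_apply]

theorem tucker_sub (X Y : Tensor d) (A : ∀ n, Matrix (Fin (e n)) (Fin (d n)) ℝ) :
    tucker (X - Y) A = tucker X A - tucker Y A := by
  funext i
  simp [tucker, mul_sub, Finset.sum_sub_distrib]

theorem tucker_update_sub (X : Tensor d) (A : ∀ n, Matrix (Fin (e n)) (Fin (d n)) ℝ) (k : Fin N)
    (B C : Matrix (Fin (e k)) (Fin (d k)) ℝ) :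
    tucker X (Function.update A k (B - C)) =
      tucker X (Function.update A k B) - tucker X (Function.update A k C) := by
  funext i
  simp only [tucker, Pi.sub_apply, ← Finset.sum_sub_distrib, ← sub_mul]
  refine Finset.sum_congr rfl fun j _ => ?_
  congr 1
  have h : ∀ D : Matrix (Fin (e k)) (Fin (d k)) ℝ,
      ∏ n, Function.update A k D n (i n) (j n) =
        D (i k) (j k) * ∏ n ∈ Finset.univ.erase k, A n (i n) (j n) := by
    intro D
    rw [← Finset.mul_prod_erase _ _ (Finset.mem_univ k), Function.update_self]
    congr 1
    refine Finset.prod_congr rfl fun n hn => ?_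
    rw [Function.update_of_ne (Finset.ne_of_mem_erase hn)]
  rw [h, h, h, Matrix.sub_apply, sub_mul]

theorem tucker_update_zero (X : Tensor d) (A : ∀ n, Matrix (Fin (e n)) (Fin (d n)) ℝ) (k : Fin N) :
    tucker X (Function.update A k 0) = 0 := by
  have h := tucker_update_sub X A k 0 0
  simpa using h

/-- The index with mode-`n` component `a` and the other components `c`. -/
def insertIndex (n : Fin N) (a : Fin (d n)) (c : ∀ k : {k : Fin N // k ≠ n}, Fin (d k)) : Index d :=
  fun k => if h : k = n then Fin.cast (by rw [h]) a else c ⟨k, h⟩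

theorem unfold_apply (n : Fin N) (X : Tensor d) (a : Fin (d n))
    (c : ∀ k : {k : Fin N // k ≠ n}, Fin (d k)) : unfold n X a c = X (insertIndex n a c) := rfl

theorem insertIndex_self (n : Fin N) (a : Fin (d n)) (c : ∀ k : {k : Fin N // k ≠ n}, Fin (d k)) :
    insertIndex n a c n = a := by simp [insertIndex]

theorem insertIndex_of_ne (n : Fin N) (a : Fin (d n))
    (c : ∀ k : {k : Fin N // k ≠ n}, Fin (d k)) (k : {k : Fin N // k ≠ n}) :
    insertIndex n a c k = c k := by simp [insertIndex, k.2]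

theorem sum_eq_sum_insertIndex {M : Type*} [AddCommMonoid M] (n : Fin N) (F : Index d → M) :
    ∑ i, F i = ∑ a, ∑ c, F (insertIndex n a c) := by
  rw [← Fintype.sum_prod_type']
  symm
  refine Fintype.sum_equiv (Equiv.piSplitAt n fun k => Fin (d k)).symm _ _ fun x => ?_
  congr 1
  funext k
  simp only [insertIndex, Equiv.piSplitAt]
  by_cases h : k = n
  · subst h; simp
  · simp [h]

theorem unfold_tucker (n : Fin N) (X : Tensor d) (A : ∀ n, Matrix (Fin (e n)) (Fin (d n)) ℝ) :
    unfold n (tucker X A) = A n * unfold n X * (kronExcept n A)ᵀ := by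
  ext a c
  rw [unfold_apply, tucker, sum_eq_sum_insertIndex n, Finset.sum_comm]
  simp only [Matrix.mul_apply, Matrix.transpose_apply, Finset.sum_mul]
  refine Finset.sum_congr rfl fun l _ => Finset.sum_congr rfl fun b _ => ?_
  rw [Fintype.prod_eq_mul_prod_subtype_ne _ n, insertIndex_self, insertIndex_self, unfold_apply,
    kronExcept]
  simp only [insertIndex_of_ne]
  ring

theorem sq_fro_eq_unfold (n : Fin N) (X : Tensor d) :
    fro X ^ 2 = ∑ a, ∑ c, unfold n X a c ^ 2 := by
  rw [sq_fro, sum_eq_sum_insertIndex n]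
  rfl

theorem fro_eq_unfold (n : Fin N) (X : Tensor d) :
    fro X = √(∑ a, ∑ c, unfold n X a c ^ 2) := by
  rw [← sq_fro_eq_unfold, Real.sqrt_sq (fro_nonneg _)]

theorem kronExcept_mul (n : Fin N) (A : ∀ n, Matrix (Fin (e n)) (Fin (d n)) ℝ)
    (B : ∀ n, Matrix (Fin (f n)) (Fin (e n)) ℝ) :
    kronExcept n B * kronExcept n A = kronExcept n fun k => B k * A k := by
  ext i j
  simp only [kronExcept, Matrix.mul_apply, Fintype.prod_sum, ← Finset.prod_mul_distrib]

theorem kronExcept_transpose (n : Fin N) (A : ∀ n, Matrix (Fin (e n)) (Fin (d n)) ℝ) :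
    (kronExcept n A)ᵀ = kronExcept n fun k => (A k)ᵀ := rfl

theorem kronExcept_congr (n : Fin N) {A B : ∀ n, Matrix (Fin (e n)) (Fin (d n)) ℝ}
    (h : ∀ k, k ≠ n → A k = B k) : kronExcept n A = kronExcept n B := by
  ext i j
  exact Finset.prod_congr rfl fun k _ => by rw [h k k.2]

theorem kronExcept_one (n : Fin N) :
    kronExcept n (fun k => (1 : Matrix (Fin (d k)) (Fin (d k)) ℝ)) = 1 := by
  classical
  ext i j
  rw [kronExcept, prod_one_apply, Matrix.one_apply]

theorem kronExcept_orthonormal (n : Fin N) {A : ∀ n, Matrix (Fin (e n)) (Fin (d n)) ℝ}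
    (hA : ∀ k, k ≠ n → (A k)ᵀ * A k = 1) : (kronExcept n A)ᵀ * kronExcept n A = 1 := by
  rw [kronExcept_transpose, kronExcept_mul, ← kronExcept_one]
  exact kronExcept_congr n hA

/-- The modal product in the mode `k` only. -/
def modeMul (k : Fin N) (B : Matrix (Fin (d k)) (Fin (d k)) ℝ) (X : Tensor d) : Tensor d :=
  tucker X (Function.update (fun _ => 1) k B)

theorem unfold_modeMul (k : Fin N) (B : Matrix (Fin (d k)) (Fin (d k)) ℝ) (X : Tensor d) :
    unfold k (modeMul k B X) = B * unfold k X := by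
  rw [modeMul, unfold_tucker, Function.update_self,
    kronExcept_congr k (B := fun _ => 1) fun j hj => Function.update_of_ne hj _ _, kronExcept_one,
    Matrix.transpose_one, Matrix.mul_one]

theorem modeMul_tucker (k : Fin N) (B : Matrix (Fin (e k)) (Fin (e k)) ℝ) (X : Tensor d)
    (A : ∀ n, Matrix (Fin (e n)) (Fin (d n)) ℝ) :
    modeMul k B (tucker X A) = tucker X (Function.update A k (B * A k)) := by
  rw [modeMul, tucker_tucker]
  congr 1
  funext n
  by_cases h : n = k
  · subst h; simp
  · simp [Function.update_of_ne h]

theorem modeMul_sub (k : Fin N) (B : Matrix (Fin (d k)) (Fin (d k)) ℝ) (X Y : Tensor d) :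
    modeMul k B (X - Y) = modeMul k B X - modeMul k B Y := tucker_sub _ _ _

/-- In the mode-`k` unfolding the modal product acts on each column separately. -/
theorem fro_modeMul_le (k : Fin N) {B : Matrix (Fin (d k)) (Fin (d k)) ℝ} {c : ℝ} (hc : 0 ≤ c)
    (hB : ∀ x, fro (B *ᵥ x) ≤ c * fro x) (X : Tensor d) :
    fro (modeMul k B X) ≤ c * fro X := by
  rw [← sq_le_sq₀ (fro_nonneg _) (mul_nonneg hc (fro_nonneg _)), mul_pow, sq_fro_eq_unfold k,
    sq_fro_eq_unfold k, unfold_modeMul, Finset.sum_comm, Finset.sum_comm (s := Finset.univ),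
    Finset.sum_comm (f := fun a c => unfold k X a c ^ 2), Finset.mul_sum]
  rw [Finset.sum_comm]
  refine Finset.sum_le_sum fun j _ => ?_
  have h := pow_le_pow_left₀ (fro_nonneg _) (hB fun b => unfold k X b j) 2
  rw [mul_pow, sq_fro, sq_fro] at h
  exact h

/-- One step of the telescoping from `C` to `B`: exchanging the matrix of one mode changes the
tensor by a modal product with `B a - C a`. -/
theorem tucker_ite_insert (X : Tensor d) (B C : ∀ n, Matrix (Fin (d n)) (Fin (d n)) ℝ)
    (S : Finset (Fin N)) (a : Fin N) (ha : a ∉ S) :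
    tucker X (fun n => if n ∈ insert a S then B n else C n) -
        tucker X (fun n => if n ∈ S then B n else C n) =
      modeMul a (B a - C a) (tucker X fun n => if n = a then 1 else if n ∈ S then B n else C n) := by
  rw [modeMul_tucker, if_pos rfl, Matrix.mul_one, tucker_update_sub]
  congr 2
  · funext n
    by_cases h : n = a
    · subst h; simp
    · simp [h]
  · funext n
    by_cases h : n = a
    · subst h; simp [ha]
    · simp [h]

theorem fro_tucker_le (X : Tensor d) {B : ∀ n, Matrix (Fin (d n)) (Fin (d n)) ℝ}
    (hB : ∀ n x, fro (B n *ᵥ x) ≤ fro x) : fro (tucker X B) ≤ fro X := by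
  suffices h : ∀ S : Finset (Fin N), fro (tucker X fun n => if n ∈ S then B n else 1) ≤ fro X by
    simpa using h Finset.univ
  intro S
  induction S using Finset.induction_on with
  | empty => simp [tucker_one]
  | insert a S ha ih =>
    have h : tucker X (fun n => if n ∈ insert a S then B n else 1) =
        modeMul a (B a) (tucker X fun n => if n ∈ S then B n else 1) := by
      rw [modeMul_tucker, if_neg ha, Matrix.mul_one]
      congr 1
      funext n
      by_cases h : n = a
      · subst h; simp
      · simp [h]
    rw [h]
    have h1 := fro_modeMul_le a zero_le_one (fun x => by simpa using hB a x)
      (tucker X fun n => if n ∈ S then B n else 1)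
    linarith

/-- Telescoping over the modes. All other matrices in a term are contractions, so the errors add
instead of multiplying. -/
theorem fro_tucker_sub_tucker_le (X : Tensor d) {B C : ∀ n, Matrix (Fin (d n)) (Fin (d n)) ℝ}
    {δ : Fin N → ℝ} (hδ : ∀ n, 0 ≤ δ n)
    (hB : ∀ n x, fro (B n *ᵥ x) ≤ fro x) (hC : ∀ n x, fro (C n *ᵥ x) ≤ fro x)
    (hBC : ∀ n x, fro ((B n - C n) *ᵥ x) ≤ δ n * fro x) :
    fro (tucker X B - tucker X C) ≤ (∑ n, δ n) * fro X := by
  suffices h : ∀ S : Finset (Fin N),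
      fro (tucker X (fun n => if n ∈ S then B n else C n) - tucker X C) ≤ (∑ n ∈ S, δ n) * fro X by
    simpa using h Finset.univ
  intro S
  induction S using Finset.induction_on with
  | empty => simp [fro_zero]
  | insert a S ha ih =>
    have h := fro_modeMul_le a (hδ a) (hBC a)
      (tucker X fun n => if n = a then 1 else if n ∈ S then B n else C n)
    rw [← tucker_ite_insert X B C S a ha] at h
    have h1 : fro (tucker X fun n => if n = a then 1 else if n ∈ S then B n else C n) ≤ fro X := by
      refine fro_tucker_le X fun n x => ?_
      split_ifs
      · rw [Matrix.one_mulVec]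
      · exact hB n x
      · exact hC n x
    have h2 := fro_add_le
      (tucker X (fun n => if n ∈ insert a S then B n else C n) -
        tucker X (fun n => if n ∈ S then B n else C n))
      (tucker X (fun n => if n ∈ S then B n else C n) - tucker X C)
    rw [sub_add_sub_cancel] at h2
    rw [Finset.sum_insert ha, add_mul]
    have h3 := mul_le_mul_of_nonneg_left h1 (hδ a)
    linarith

end Tucker

/-! ### A matrix Chernoff bound for independent rank-one matrices -/

section Chernoff

open Finset

theorem trace_mul_vecMulVec {ι : Type*} [Fintype ι] (M : Matrix ι ι ℝ) (v : ι → ℝ) :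
    (M * Matrix.vecMulVec v v).trace = v ⬝ᵥ M *ᵥ v := by
  rw [Matrix.mul_vecMulVec, Matrix.trace_vecMulVec, dotProduct_comm]

theorem posSemidef_vecMulVec {ι : Type*} [Fintype ι] (v : ι → ℝ) : (Matrix.vecMulVec v v).PosSemidef := by
  simpa using Matrix.posSemidef_vecMulVec_self_star v

variable {ι : Type*} [Fintype ι] [DecidableEq ι]

/-- Spectral decomposition of the powers of a positive semidefinite matrix. -/
theorem exists_spectral {K : Matrix ι ι ℝ} (hK : K.PosSemidef) :
    ∃ (l : ι → ℝ) (e : ι → ι → ℝ), (∀ a, 0 ≤ l a) ∧ (∀ a, e a ⬝ᵥ e a = 1) ∧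
      (∀ a, l a = e a ⬝ᵥ K *ᵥ e a) ∧
      (∀ v k, v ⬝ᵥ K ^ k *ᵥ v = ∑ a, l a ^ k * (e a ⬝ᵥ v) ^ 2) ∧
      ∀ k, (K ^ k).trace = ∑ a, l a ^ k := by
  have hH := hK.isHermitian
  set l := hH.eigenvalues
  set e : ι → ι → ℝ := fun a => WithLp.ofLp (hH.eigenvectorBasis a)
  have he : ∀ a, K *ᵥ e a = l a • e a := fun a => hH.mulVec_eigenvectorBasis a
  have hone : ∀ a, e a ⬝ᵥ e a = 1 := by
    intro a
    have h := sq_fro_eq_dotProduct (e a)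
    rw [fro_ofLp, hH.eigenvectorBasis.orthonormal.1 a, one_pow] at h
    exact h.symm
  have hpow : ∀ a k, K ^ k *ᵥ e a = l a ^ k • e a := by
    intro a k
    induction k with
    | zero => simp
    | succ k ih => rw [pow_succ, ← Matrix.mulVec_mulVec, he, Matrix.mulVec_smul, ih, smul_smul,
        pow_succ, mul_comm]
  have hsymm : ∀ k, (K ^ k)ᵀ = K ^ k := by
    intro k
    have h : Kᵀ = K := by simpa [Matrix.IsHermitian] using hH
    rw [Matrix.transpose_pow, h]
  have hquad : ∀ v k, v ⬝ᵥ K ^ k *ᵥ v = ∑ a, l a ^ k * (e a ⬝ᵥ v) ^ 2 := by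
    intro v k
    have h := hH.eigenvectorBasis.sum_inner_mul_inner (WithLp.toLp 2 v)
      (WithLp.toLp 2 (K ^ k *ᵥ v))
    have h1 : ∀ x y : EuclideanSpace ℝ ι, inner ℝ x y = WithLp.ofLp x ⬝ᵥ WithLp.ofLp y := by
      intro x y
      simp [PiLp.inner_apply, dotProduct, mul_comm]
    simp only [h1] at h
    rw [← h]
    refine Finset.sum_congr rfl fun a _ => ?_
    have h2 : e a ⬝ᵥ K ^ k *ᵥ v = l a ^ k * (e a ⬝ᵥ v) := by
      rw [Matrix.dotProduct_mulVec, ← Matrix.mulVec_transpose, hsymm, hpow, smul_dotProduct,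
        smul_eq_mul]
    change v ⬝ᵥ e a * (e a ⬝ᵥ K ^ k *ᵥ v) = _
    rw [h2, dotProduct_comm v]
    ring
  refine ⟨l, e, hK.eigenvalues_nonneg, hone, fun a => ?_, hquad, fun k => ?_⟩
  · rw [he, dotProduct_smul, hone, smul_eq_mul, mul_one]
  · have h : (K ^ k).trace = ∑ i, (Pi.single i 1 : ι → ℝ) ⬝ᵥ K ^ k *ᵥ Pi.single i 1 := by
      simp [Matrix.trace]
    rw [h]
    simp only [hquad]
    rw [Finset.sum_comm]
    refine Finset.sum_congr rfl fun a _ => ?_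
    rw [← Finset.mul_sum]
    simp only [dotProduct_single, mul_one, sq]
    rw [show ∑ i, e a i * e a i = 1 from hone a, mul_one]

/-- Chebyshev's sum inequality for the spectral measure of `K` at `v`: on the nonnegative spectrum
both `λ ^ i` and `λ ^ j` are increasing in `λ`, hence positively correlated. -/
theorem moment_mul_moment_le {K : Matrix ι ι ℝ} (hK : K.PosSemidef) (v : ι → ℝ) (i j : ℕ) :
    (v ⬝ᵥ K ^ i *ᵥ v) * (v ⬝ᵥ K ^ j *ᵥ v) ≤ (v ⬝ᵥ v) * (v ⬝ᵥ K ^ (i + j) *ᵥ v) := by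
  obtain ⟨l, e, hl, -, -, hq, -⟩ := exists_spectral hK
  have h0 : v ⬝ᵥ v = ∑ a, (e a ⬝ᵥ v) ^ 2 := by simpa using hq v 0
  rw [h0, hq, hq, hq, Finset.sum_mul_sum, Finset.sum_mul_sum]
  set w := fun a => (e a ⬝ᵥ v) ^ 2
  have hw : ∀ a, 0 ≤ w a := fun a => sq_nonneg _
  have h1 : ∑ a, ∑ b, w a * (l b ^ (i + j) * w b) = ∑ a, ∑ b, w b * (l a ^ (i + j) * w a) :=
    Finset.sum_comm
  have h2 : ∑ a, ∑ b, l a ^ i * w a * (l b ^ j * w b) =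
      ∑ a, ∑ b, l b ^ i * w b * (l a ^ j * w a) := Finset.sum_comm
  -- Symmetrized over two copies of the measure, the covariance is a sum of nonnegative terms.
  have h3 : 0 ≤ ∑ a, ∑ b, w a * w b * ((l a ^ i - l b ^ i) * (l a ^ j - l b ^ j)) := by
    refine Finset.sum_nonneg fun a _ => Finset.sum_nonneg fun b _ =>
      mul_nonneg (mul_nonneg (hw a) (hw b)) ?_
    rcases le_total (l a) (l b) with h | h
    · exact mul_nonneg_of_nonpos_of_nonpos (sub_nonpos.2 (pow_le_pow_left₀ (hl a) h i))
        (sub_nonpos.2 (pow_le_pow_left₀ (hl a) h j))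
    · exact mul_nonneg (sub_nonneg.2 (pow_le_pow_left₀ (hl b) h i))
        (sub_nonneg.2 (pow_le_pow_left₀ (hl b) h j))
  have h4 : ∑ a, ∑ b, w a * w b * ((l a ^ i - l b ^ i) * (l a ^ j - l b ^ j)) =
      (∑ a, ∑ b, w b * (l a ^ (i + j) * w a) + ∑ a, ∑ b, w a * (l b ^ (i + j) * w b)) -
      (∑ a, ∑ b, l a ^ i * w a * (l b ^ j * w b) +
        ∑ a, ∑ b, l b ^ i * w b * (l a ^ j * w a)) := by
    simp only [← Finset.sum_add_distrib, ← Finset.sum_sub_distrib]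
    refine Finset.sum_congr rfl fun a _ => Finset.sum_congr rfl fun b _ => ?_
    ring
  change ∑ a, ∑ b, l a ^ i * w a * (l b ^ j * w b) ≤ ∑ a, ∑ b, w a * (l b ^ (i + j) * w b)
  linarith

/-- The trace of the exponential series truncated after `m` terms. -/
def expTrace (m : ℕ) (K : Matrix ι ι ℝ) : ℝ := ∑ k ∈ range m, (K ^ k).trace / k.factorial

theorem expTrace_le {K : Matrix ι ι ℝ} (hK : K.PosSemidef) {c : ℝ} (hc0 : 0 ≤ c)
    (hc : ∀ x, x ⬝ᵥ K *ᵥ x ≤ c * (x ⬝ᵥ x)) (m : ℕ) :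
    expTrace m K ≤ Fintype.card ι * Real.exp c := by
  obtain ⟨l, e, hl, he, hle, -, ht⟩ := exists_spectral hK
  have hlc : ∀ a, l a ≤ c := fun a => by
    rw [hle]; simpa [he] using hc (e a)
  have h1 : ∀ k, (K ^ k).trace ≤ Fintype.card ι * c ^ k := by
    intro k
    rw [ht]
    refine (Finset.sum_le_sum fun a _ => pow_le_pow_left₀ (hl a) (hlc a) k).trans ?_
    simp
  calc expTrace m K ≤ ∑ k ∈ range m, Fintype.card ι * (c ^ k / k.factorial) := by
        refine Finset.sum_le_sum fun k _ => ?_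
        rw [← mul_div_assoc]
        exact div_le_div_of_nonneg_right (h1 k) (Nat.cast_nonneg _)
    _ ≤ Fintype.card ι * Real.exp c := by
        rw [← Finset.mul_sum]
        exact mul_le_mul_of_nonneg_left (Real.sum_le_exp_of_nonneg hc0 m) (Nat.cast_nonneg _)

theorem expTrace_nonneg {K : Matrix ι ι ℝ} (hK : K.PosSemidef) (m : ℕ) : 0 ≤ expTrace m K := by
  obtain ⟨l, e, hl, -, -, -, ht⟩ := exists_spectral hK
  refine Finset.sum_nonneg fun k _ => div_nonneg ?_ (Nat.cast_nonneg _)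
  rw [ht]
  exact Finset.sum_nonneg fun a _ => pow_nonneg (hl a) k

/-- Jensen's inequality for the weights `(e a ⬝ᵥ u) ^ 2`, which sum to one. Each weight is at most
one, so the average of `l a ^ k` is at most the trace. -/
theorem le_expTrace {K : Matrix ι ι ℝ} (hK : K.PosSemidef) {u : ι → ℝ} (hu : u ⬝ᵥ u = 1) {t : ℝ}
    (ht0 : 0 ≤ t) (ht : t ≤ u ⬝ᵥ K *ᵥ u) (m : ℕ) :
    ∑ k ∈ range m, t ^ k / k.factorial ≤ expTrace m K := by
  obtain ⟨l, e, hl, -, -, hq, htr⟩ := exists_spectral hK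
  have hw : ∑ a, (e a ⬝ᵥ u) ^ 2 = 1 := by simpa [hu] using (hq u 0).symm
  have h1 : t ≤ ∑ a, (e a ⬝ᵥ u) ^ 2 * l a := by
    have := hq u 1
    simp only [pow_one] at this
    rw [this] at ht
    simpa only [mul_comm] using ht
  refine Finset.sum_le_sum fun k _ => div_le_div_of_nonneg_right ?_ (Nat.cast_nonneg _)
  calc t ^ k ≤ (∑ a, (e a ⬝ᵥ u) ^ 2 * l a) ^ k := pow_le_pow_left₀ ht0 h1 k
    _ ≤ ∑ a, (e a ⬝ᵥ u) ^ 2 * l a ^ k :=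
        Real.pow_arith_mean_le_arith_mean_pow univ _ _ (fun a _ => sq_nonneg _) hw
          (fun a _ => hl a) k
    _ ≤ (K ^ k).trace := by
        rw [htr]
        refine Finset.sum_le_sum fun a _ => mul_le_of_le_one_left (pow_nonneg (hl a) k) ?_
        rw [← hw]
        exact Finset.single_le_sum (f := fun a => (e a ⬝ᵥ u) ^ 2) (fun a _ => sq_nonneg _)
          (mem_univ a)

/-! ### Derivatives along a rank-one perturbation -/

section Derivative

attribute [local instance] Matrix.linftyOpNormedRing Matrix.linftyOpNormedAlgebra

/-- The noncommutative product rule for powers. The functional `L` covers the trace and the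
quadratic form at once; the norm on matrices is auxiliary. -/
theorem hasDerivAt_linear_pow (L : Matrix ι ι ℝ →ₗ[ℝ] ℝ) (H P : Matrix ι ι ℝ) (k : ℕ) (s : ℝ) :
    HasDerivAt (fun s : ℝ => L ((H + s • P) ^ k))
      (∑ i ∈ range k, L ((H + s • P) ^ (k - 1 - i) * P * (H + s • P) ^ i)) s := by
  have h1 : HasDerivAt (fun s : ℝ => H + s • P) P s := by
    have h := ((hasDerivAt_id s).smul_const P).const_add H
    rw [one_smul] at h
    exact h
  have h2 := L.toContinuousLinearMap.hasFDerivAt.comp_hasDerivAt s (h1.fun_pow' k)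
  exact h2.congr_deriv (map_sum L _ _)

end Derivative

/-- Under the trace the `k` terms of the product rule coincide by cyclicity. -/
theorem hasDerivAt_trace_pow (H : Matrix ι ι ℝ) (v : ι → ℝ) (k : ℕ) (s : ℝ) :
    HasDerivAt (fun s : ℝ => ((H + s • Matrix.vecMulVec v v) ^ k).trace)
      (k * (v ⬝ᵥ (H + s • Matrix.vecMulVec v v) ^ (k - 1) *ᵥ v)) s := by
  have h := hasDerivAt_linear_pow (Matrix.traceLinearMap ι ℝ ℝ) H (Matrix.vecMulVec v v) k s
  simp only [Matrix.traceLinearMap_apply] at h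
  convert h using 1
  rw [Finset.sum_congr rfl (g := fun _ =>
    v ⬝ᵥ (H + s • Matrix.vecMulVec v v) ^ (k - 1) *ᵥ v)]
  · simp
  · intro i hi
    rw [Matrix.trace_mul_cycle, ← pow_add, trace_mul_vecMulVec]
    congr 3
    have := mem_range.1 hi
    omega

/-- Here rank one is essential: inserting `v vᵀ` splits each term of the product rule into a product
of two moments, to which `moment_mul_moment_le` applies. -/
theorem hasDerivAt_quadForm_pow (H : Matrix ι ι ℝ) (v : ι → ℝ) (k : ℕ) (s : ℝ) :
    HasDerivAt (fun s : ℝ => v ⬝ᵥ (H + s • Matrix.vecMulVec v v) ^ k *ᵥ v)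
      (∑ i ∈ range k, (v ⬝ᵥ (H + s • Matrix.vecMulVec v v) ^ (k - 1 - i) *ᵥ v) *
        (v ⬝ᵥ (H + s • Matrix.vecMulVec v v) ^ i *ᵥ v)) s := by
  have h := hasDerivAt_linear_pow ((Matrix.traceLinearMap ι ℝ ℝ).comp
    (LinearMap.mulRight ℝ (Matrix.vecMulVec v v))) H (Matrix.vecMulVec v v) k s
  simp only [LinearMap.comp_apply, Matrix.traceLinearMap_apply, LinearMap.mulRight_apply,
    trace_mul_vecMulVec] at h
  convert h using 1
  refine Finset.sum_congr rfl fun i _ => ?_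
  rw [Matrix.mul_vecMulVec, Matrix.vecMulVec_mul, Matrix.vecMulVec_mulVec,
    ← Matrix.dotProduct_mulVec, dotProduct_comm]
  simp [mul_comm, dotProduct_comm]

/-- A function with `f'' ≤ f'` is concave as a function of `exp`. -/
theorem convexComb_le_of_deriv_le {f g h : ℝ → ℝ} (hf : ∀ s, HasDerivAt f (g s) s)
    (hg : ∀ s, HasDerivAt g (h s) s) (hgh : ∀ s, 0 ≤ s → s ≤ 1 → h s ≤ g s) {q : ℝ} (hq0 : 0 ≤ q)
    (hq1 : q ≤ 1) :
    (1 - q) * f 0 + q * f 1 ≤ f (Real.log (1 - q + q * Real.exp 1)) := by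
  -- The derivative of `f ∘ log` at `y = exp s` is `exp (-s) * f' s`, which decreases because `f'' ≤
  -- f'`.
  have hanti : AntitoneOn (fun s => Real.exp (-s) * g s) (Set.Icc 0 1) := by
    have hd : ∀ s, HasDerivAt (fun s => Real.exp (-s) * g s)
        (Real.exp (-s) * (h s - g s)) s := by
      intro s
      refine ((hasDerivAt_neg s).exp.mul (hg s)).congr_deriv ?_
      ring
    refine antitoneOn_of_deriv_nonpos (convex_Icc 0 1)
      (fun s _ => (hd s).continuousAt.continuousWithinAt)
      (fun s _ => (hd s).differentiableAt.differentiableWithinAt) fun s hs => ?_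
    rw [interior_Icc] at hs
    rw [(hd s).deriv]
    exact mul_nonpos_of_nonneg_of_nonpos (Real.exp_pos _).le
      (sub_nonpos.2 (hgh s hs.1.le hs.2.le))
  have he : (1 : ℝ) ≤ Real.exp 1 := Real.one_le_exp zero_le_one
  have hd : ∀ y : ℝ, 1 ≤ y → HasDerivAt (fun y => f (Real.log y))
      (Real.exp (-Real.log y) * g (Real.log y)) y := by
    intro y hy
    have hy0 : 0 < y := by linarith
    refine ((hf (Real.log y)).comp y (Real.hasDerivAt_log hy0.ne')).congr_deriv ?_
    rw [Real.exp_neg, Real.exp_log hy0, mul_comm]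
  have hmem : ∀ y ∈ Set.Icc 1 (Real.exp 1), Real.log y ∈ Set.Icc (0 : ℝ) 1 := by
    intro y hy
    exact ⟨Real.log_nonneg hy.1, (Real.log_le_iff_le_exp (by linarith [hy.1])).2 hy.2⟩
  have hconc : ConcaveOn ℝ (Set.Icc 1 (Real.exp 1)) fun y => f (Real.log y) := by
    refine AntitoneOn.concaveOn_of_deriv (convex_Icc _ _)
      (fun y hy => (hd y hy.1).continuousAt.continuousWithinAt)
      (fun y hy => (hd y (interior_subset hy).1).differentiableAt.differentiableWithinAt) ?_
    intro y hy z hz hyz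
    have hy' := interior_subset hy
    have hz' := interior_subset hz
    rw [(hd y hy'.1).deriv, (hd z hz'.1).deriv]
    exact hanti (hmem y hy') (hmem z hz') (Real.log_le_log (by linarith [hy'.1]) hyz)
  -- Concavity between `1 = exp 0` and `exp 1`, at the point `1 - q + q * exp 1`.
  have h1 := hconc.2 (Set.left_mem_Icc.2 he) (Set.right_mem_Icc.2 he) (sub_nonneg.2 hq1) hq0
    (by ring)
  simpa using h1

/-- Replacing a random rank-one summand by a deterministic one increases the expected trace of
the exponential. This is the rank-one case of Lieb's concavity theorem. -/
theorem expTrace_rankOne_le {H : Matrix ι ι ℝ} (hH : H.PosSemidef) {v : ι → ℝ} (hv : v ⬝ᵥ v ≤ 1)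
    {q : ℝ} (hq0 : 0 ≤ q) (hq1 : q ≤ 1) (m : ℕ) :
    (1 - q) * expTrace m H + q * expTrace m (H + Matrix.vecMulVec v v) ≤
      expTrace m (H + Real.log (1 - q + q * Real.exp 1) • Matrix.vecMulVec v v) := by
  cases m with
  | zero => simp [expTrace]
  | succ m =>
  set K : ℝ → Matrix ι ι ℝ := fun s => H + s • Matrix.vecMulVec v v
  have hK : ∀ s, 0 ≤ s → (K s).PosSemidef := fun s hs =>
    hH.add ((posSemidef_vecMulVec v).smul hs)
  have hf : ∀ s, HasDerivAt (fun s => expTrace (m + 1) (K s))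
      (∑ k ∈ range m, (v ⬝ᵥ K s ^ k *ᵥ v) / k.factorial) s := by
    intro s
    have h1 := HasDerivAt.fun_sum (u := range (m + 1)) fun k _ =>
      (hasDerivAt_trace_pow H v k s).div_const (k.factorial : ℝ)
    refine h1.congr_deriv ?_
    rw [Finset.sum_range_succ']
    simp only [Nat.cast_zero, zero_mul, zero_div, add_zero, Nat.add_sub_cancel]
    refine Finset.sum_congr rfl fun k _ => ?_
    rw [Nat.factorial_succ, Nat.cast_mul, mul_div_mul_left]
    exact Nat.cast_ne_zero.2 k.succ_ne_zero
  have hg : ∀ s, HasDerivAt (fun s => ∑ k ∈ range m, (v ⬝ᵥ K s ^ k *ᵥ v) / k.factorial)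
      (∑ k ∈ range m, (∑ i ∈ range k, (v ⬝ᵥ K s ^ (k - 1 - i) *ᵥ v) *
        (v ⬝ᵥ K s ^ i *ᵥ v)) / k.factorial) s := by
    intro s
    exact HasDerivAt.fun_sum fun k _ => (hasDerivAt_quadForm_pow H v k s).div_const _
  have hnn : ∀ s, 0 ≤ s → ∀ k, 0 ≤ v ⬝ᵥ K s ^ k *ᵥ v := by
    intro s hs k
    simpa using ((hK s hs).pow k).dotProduct_mulVec_nonneg v
  have h := convexComb_le_of_deriv_le hf hg ?_ hq0 hq1
  · simpa [K] using h
  intro s hs0 _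
  cases m with
  | zero => simp
  | succ m =>
  -- The inequality `f'' ≤ f'` is checked term by term. The term of index `k + 1` on the left has `k
  -- + 1` products of moments over `(k + 1)!`, each at most the moment of order `k`. It is compared
  -- with the term of index `k` on the right, whose last term is left over.
  rw [Finset.sum_range_succ', Finset.sum_range_succ]
  simp only [Finset.range_zero, Finset.sum_empty, zero_div, add_zero]
  refine le_add_of_le_of_nonneg (Finset.sum_le_sum fun k _ => ?_)
    (div_nonneg (hnn s hs0 m) (Nat.cast_nonneg _))
  rw [Nat.factorial_succ, Nat.cast_mul, ← mul_div_mul_left (v ⬝ᵥ K s ^ k *ᵥ v) _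
    (Nat.cast_ne_zero.2 k.succ_ne_zero : ((k + 1 : ℕ) : ℝ) ≠ 0)]
  refine div_le_div_of_nonneg_right ?_ (by positivity)
  calc ∑ i ∈ range (k + 1), (v ⬝ᵥ K s ^ (k + 1 - 1 - i) *ᵥ v) * (v ⬝ᵥ K s ^ i *ᵥ v)
      ≤ ∑ i ∈ range (k + 1), v ⬝ᵥ K s ^ k *ᵥ v := by
        refine Finset.sum_le_sum fun i hi => ?_
        have h1 := moment_mul_moment_le (hK s hs0) v (k + 1 - 1 - i) i
        rw [show k + 1 - 1 - i + i = k by have := mem_range.1 hi; omega] at h1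
        exact h1.trans (mul_le_of_le_one_left (hnn s hs0 k) hv)
    _ = _ := by simp

/-! ### Expectation over the random index set -/

variable {τ : Type*} [DecidableEq τ]

/-- The probability of drawing `Ω` from `S`. -/
def drawWeight (p : ℝ) (S Ω : Finset τ) : ℝ := p ^ Ω.card * (1 - p) ^ (S \ Ω).card

theorem drawWeight_nonneg {p : ℝ} (hp0 : 0 ≤ p) (hp1 : p ≤ 1) (S Ω : Finset τ) :
    0 ≤ drawWeight p S Ω :=
  mul_nonneg (pow_nonneg hp0 _) (pow_nonneg (sub_nonneg.2 hp1) _)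

theorem sum_powerset_insert_drawWeight {p : ℝ} {S : Finset τ} {a : τ} (ha : a ∉ S)
    (F : Finset τ → ℝ) :
    ∑ Ω ∈ (insert a S).powerset, drawWeight p (insert a S) Ω * F Ω =
      ∑ Ω ∈ S.powerset, drawWeight p S Ω * ((1 - p) * F Ω + p * F (insert a Ω)) := by
  rw [Finset.sum_powerset_insert ha, ← Finset.sum_add_distrib]
  refine Finset.sum_congr rfl fun Ω hΩ => ?_
  have haΩ : a ∉ Ω := fun h => ha (Finset.mem_powerset.1 hΩ h)
  have h1 : (insert a S \ Ω).card = (S \ Ω).card + 1 := by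
    rw [Finset.insert_sdiff_of_notMem _ haΩ, Finset.card_insert_of_notMem]
    simp [ha]
  have h2 : (insert a S \ insert a Ω) = S \ Ω := by
    rw [Finset.insert_sdiff_insert, Finset.sdiff_insert_of_notMem ha]
  simp only [drawWeight]
  rw [h1, h2, Finset.card_insert_of_notMem haΩ]
  ring

/-- Induction over the indices: with the others fixed, the random summand is exchanged for its
deterministic substitute. The matrix `H` is general because it collects the substitutes made so far.
-/
theorem sum_drawWeight_expTrace_le {v : τ → ι → ℝ} (hv : ∀ i, v i ⬝ᵥ v i ≤ 1) {p : ℝ}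
    (hp0 : 0 ≤ p) (hp1 : p ≤ 1) (m : ℕ) (S : Finset τ) {H : Matrix ι ι ℝ} (hH : H.PosSemidef) :
    ∑ Ω ∈ S.powerset, drawWeight p S Ω * expTrace m (H + ∑ i ∈ Ω, Matrix.vecMulVec (v i) (v i)) ≤
      expTrace m (H + Real.log (1 - p + p * Real.exp 1) •
        ∑ i ∈ S, Matrix.vecMulVec (v i) (v i)) := by
  induction S using Finset.induction_on generalizing H with
  | empty => simp [drawWeight]
  | insert a S ha ih =>
    have hs : 0 ≤ Real.log (1 - p + p * Real.exp 1) := by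
      refine Real.log_nonneg ?_
      nlinarith [Real.one_le_exp (zero_le_one' ℝ)]
    have hH' := hH.add ((posSemidef_vecMulVec (v a)).smul hs)
    rw [sum_powerset_insert_drawWeight ha, Finset.sum_insert ha, smul_add, ← add_assoc]
    refine le_trans (Finset.sum_le_sum fun Ω hΩ => ?_) (ih hH')
    refine mul_le_mul_of_nonneg_left ?_ (drawWeight_nonneg hp0 hp1 _ _)
    have haΩ : a ∉ Ω := fun h => ha (Finset.mem_powerset.1 hΩ h)
    have hΩH : (H + ∑ i ∈ Ω, Matrix.vecMulVec (v i) (v i)).PosSemidef :=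
      hH.add (Matrix.posSemidef_sum _ fun i _ => posSemidef_vecMulVec (v i))
    have h1 := expTrace_rankOne_le hΩH (hv a) hp0 hp1 m
    rw [Finset.sum_insert haΩ, add_right_comm H, ← add_assoc, add_right_comm H]
    rw [add_right_comm H, add_right_comm H] at h1
    exact h1

open Classical in
/-- Upper tail of a sum of independent rank-one matrices. -/
theorem upper_tail [Fintype τ] {v : τ → ι → ℝ} (hv : ∀ i, v i ⬝ᵥ v i ≤ 1) {p : ℝ}
    (hp0 : 0 ≤ p) (hp1 : p ≤ 1) {c t : ℝ} (hc0 : 0 ≤ c) (ht : 0 ≤ t)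
    (hc : ∀ x : ι → ℝ, ∑ i, (v i ⬝ᵥ x) ^ 2 ≤ c * (x ⬝ᵥ x)) :
    (∑ Ω with ∃ u : ι → ℝ, u ⬝ᵥ u = 1 ∧ t ≤ ∑ i ∈ Ω, (v i ⬝ᵥ u) ^ 2, drawWeight p univ Ω) *
        Real.exp t ≤
      Fintype.card ι * Real.exp (Real.log (1 - p + p * Real.exp 1) * c) := by
  have hquad : ∀ (Ω : Finset τ) (x : ι → ℝ),
      x ⬝ᵥ (∑ i ∈ Ω, Matrix.vecMulVec (v i) (v i)) *ᵥ x = ∑ i ∈ Ω, (v i ⬝ᵥ x) ^ 2 := by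
    intro Ω x
    rw [Matrix.sum_mulVec, dotProduct_sum]
    refine Finset.sum_congr rfl fun i _ => ?_
    rw [Matrix.vecMulVec_mulVec]
    simp [dotProduct_comm, sq]
  have hpsd : ∀ Ω : Finset τ, (∑ i ∈ Ω, Matrix.vecMulVec (v i) (v i)).PosSemidef := fun Ω =>
    Matrix.posSemidef_sum _ fun i _ => posSemidef_vecMulVec (v i)
  set s := Real.log (1 - p + p * Real.exp 1)
  have hs : 0 ≤ s := by
    refine Real.log_nonneg ?_
    nlinarith [Real.one_le_exp (zero_le_one' ℝ)]
  set B : Finset (Finset τ) :=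
    univ.filter fun Ω => ∃ u : ι → ℝ, u ⬝ᵥ u = 1 ∧ t ≤ ∑ i ∈ Ω, (v i ⬝ᵥ u) ^ 2
  -- Markov's inequality for the trace of the truncated series. Its right-hand side does not depend
  -- on `m`, so the limit `m → ∞` recovers `exp t`.
  have hm : ∀ m : ℕ, (∑ Ω ∈ B, drawWeight p univ Ω) * ∑ k ∈ range m, t ^ k / k.factorial ≤
      Fintype.card ι * Real.exp (s * c) := by
    intro m
    have h1 := sum_drawWeight_expTrace_le hv hp0 hp1 m univ (Matrix.PosSemidef.zero (n := ι))
    simp only [zero_add, Finset.powerset_univ] at h1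
    refine le_trans ?_ (h1.trans (expTrace_le ((hpsd univ).smul hs) (mul_nonneg hs hc0) ?_ m))
    · rw [Finset.sum_mul]
      refine le_trans (Finset.sum_le_sum fun Ω hΩ => ?_)
        (Finset.sum_le_sum_of_subset_of_nonneg (Finset.filter_subset _ _) fun Ω _ _ =>
          mul_nonneg (drawWeight_nonneg hp0 hp1 _ _) (expTrace_nonneg (hpsd Ω) m))
      obtain ⟨u, hu, htu⟩ := (Finset.mem_filter.1 hΩ).2
      exact mul_le_mul_of_nonneg_left (le_expTrace (hpsd Ω) hu ht (by rwa [hquad]) m)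
        (drawWeight_nonneg hp0 hp1 _ _)
    · intro x
      rw [Matrix.smul_mulVec, dotProduct_smul, hquad, smul_eq_mul, mul_assoc]
      exact mul_le_mul_of_nonneg_left (hc x) hs
  have hlim : Filter.Tendsto (fun m : ℕ => (∑ Ω ∈ B, drawWeight p univ Ω) *
      ∑ k ∈ range m, t ^ k / k.factorial) Filter.atTop
      (nhds ((∑ Ω ∈ B, drawWeight p univ Ω) * Real.exp t)) := by
    refine Filter.Tendsto.const_mul _ ?_
    rw [Real.exp_eq_exp_ℝ]
    exact (NormedSpace.expSeries_div_hasSum_exp t).tendsto_sum_nat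
  exact le_of_tendsto' hlim hm

end Chernoff

/-! ### Sampling on the range of an orthogonal projection -/

section Sampling

open Finset

theorem sq_fro_mask {τ : Type*} [Fintype τ] (Ω : Finset τ) (x : τ → ℝ) :
    fro (mask (Ω : Set τ) x) ^ 2 = ∑ i ∈ Ω, x i ^ 2 := by
  rw [sq_fro, ← Finset.sum_subset (Finset.subset_univ Ω)]
  · refine Finset.sum_congr rfl fun i hi => ?_
    rw [mask, Set.indicator_of_mem (Finset.mem_coe.2 hi)]
  · intro i _ hi
    rw [mask, Set.indicator_of_notMem (fun h => hi (Finset.mem_coe.1 h)), zero_pow two_ne_zero]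

variable {τ : Type*} [Fintype τ] [DecidableEq τ]

theorem drawWeight_compl (p : ℝ) (Ω : Finset τ) :
    drawWeight (1 - p) univ Ωᶜ = drawWeight p univ Ω := by
  simp only [drawWeight, sub_sub_cancel, ← Finset.compl_eq_univ_sdiff, compl_compl]
  exact mul_comm _ _

open Classical in
/-- With high probability the sampling operator is well conditioned on the range of an orthogonal
projection with small diagonal entries. -/
theorem sum_drawWeight_illConditioned_le {P : Matrix τ τ ℝ} (hs : Pᵀ = P) (hi : P * P = P) {ρ : ℝ}
    (hρ : 0 < ρ) (hd : ∀ i, P i i ≤ ρ) {p : ℝ} (hp0 : 0 ≤ p) (hp1 : p ≤ 1) :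
    ∑ Ω with ¬ ∀ x : τ → ℝ, P *ᵥ x = x →
        p / 4 * fro x ^ 2 ≤ ∑ i ∈ Ω, x i ^ 2 ∧ ∑ i ∈ Ω, x i ^ 2 ≤ 2 * p * fro x ^ 2,
      drawWeight p univ Ω ≤ 2 * (Fintype.card τ * Real.exp (-(p / (4 * ρ)))) := by
  -- The rows of `P`, scaled so that `|v i|² = P i i / ρ ≤ 1`. The sum of all `v i (v i)ᵀ` is `P /
  -- ρ`, and for `x` in the range of `P` the sum of `(v i ⬝ᵥ x) ^ 2` over `Ω` is the sampled energy
  -- divided by `ρ`.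
  set v : τ → τ → ℝ := fun i => √(1 / ρ) • P i
  have hρ' : 0 ≤ 1 / ρ := by positivity
  have hvx : ∀ i x, v i ⬝ᵥ x = √(1 / ρ) * (P *ᵥ x) i := fun i x => smul_dotProduct _ _ _
  have hvx2 : ∀ i x, (v i ⬝ᵥ x) ^ 2 = 1 / ρ * (P *ᵥ x) i ^ 2 := fun i x => by
    rw [hvx, mul_pow, Real.sq_sqrt hρ']
  have hv : ∀ i, v i ⬝ᵥ v i ≤ 1 := by
    intro i
    have h1 : P i ⬝ᵥ P i = P i i := by
      conv_rhs => rw [← hi, Matrix.mul_apply]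
      refine Finset.sum_congr rfl fun j _ => ?_
      conv_lhs => rw [← hs]
      rw [Matrix.transpose_apply, ← congrFun (congrFun hs i) j, Matrix.transpose_apply]
    rw [smul_dotProduct, dotProduct_smul, h1, smul_eq_mul, smul_eq_mul, ← mul_assoc,
      Real.mul_self_sqrt hρ', one_div, inv_mul_le_iff₀ hρ, mul_one]
    exact hd i
  have hc : ∀ x : τ → ℝ, ∑ i, (v i ⬝ᵥ x) ^ 2 ≤ 1 / ρ * (x ⬝ᵥ x) := by
    intro x
    simp only [hvx2]
    rw [← Finset.mul_sum, ← sq_fro, ← sq_fro_eq_dotProduct]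
    exact mul_le_mul_of_nonneg_left
      (pow_le_pow_left₀ (fro_nonneg _) (fro_mulVec_le_of_proj hs hi x) 2) hρ'
  have he1 := Real.exp_one_gt_d9
  have he2 := Real.exp_one_lt_d9
  -- Too little energy in `Ω`, at most `p / 4`, means at least `1 - p / 4` in the complement. The
  -- complement is drawn with probability `1 - p`, so the lower tail is an upper tail too.
  set tU := 2 * p / ρ
  set tL := (1 - p / 4) / ρ
  have htU : 0 ≤ tU := by positivity
  have htL : 0 ≤ tL := div_nonneg (by linarith) hρ.le
  have hU := upper_tail hv hp0 hp1 hρ' htU hc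
  have hL := upper_tail hv (sub_nonneg.2 hp1) (sub_le_self 1 hp0) hρ' htL hc
  set BU : Finset (Finset τ) :=
    univ.filter fun Ω => ∃ u : τ → ℝ, u ⬝ᵥ u = 1 ∧ tU ≤ ∑ i ∈ Ω, (v i ⬝ᵥ u) ^ 2
  set BL : Finset (Finset τ) :=
    univ.filter fun Ω => ∃ u : τ → ℝ, u ⬝ᵥ u = 1 ∧ tL ≤ ∑ i ∈ Ω, (v i ⬝ᵥ u) ^ 2
  have hbound : ∀ {w s t : ℝ}, w * Real.exp t ≤ Fintype.card τ * Real.exp (s * (1 / ρ)) →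
      s * (1 / ρ) - t ≤ -(p / (4 * ρ)) → w ≤ Fintype.card τ * Real.exp (-(p / (4 * ρ))) := by
    intro w s t h1 h2
    have h3 : w ≤ Fintype.card τ * Real.exp (s * (1 / ρ) - t) := by
      rw [Real.exp_sub, ← mul_div_assoc]
      exact (le_div_iff₀ (Real.exp_pos t)).2 h1
    exact h3.trans (mul_le_mul_of_nonneg_left (Real.exp_le_exp.2 h2) (Nat.cast_nonneg _))
  have hρ4 : -(p / (4 * ρ)) = (-(p / 4)) * (1 / ρ) := by field_simp
  -- The exponent works because `(e - 1) - 2 < -1/4`.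
  have hU' := hbound hU (by
    have h1 : Real.log (1 - p + p * Real.exp 1) ≤ p * (Real.exp 1 - 1) := by
      refine (Real.log_le_sub_one_of_pos (by nlinarith)).trans (le_of_eq (by ring))
    have h2 : tU = 2 * p * (1 / ρ) := by simp only [tU]; ring
    rw [h2, hρ4, ← sub_mul]
    exact mul_le_mul_of_nonneg_right (by nlinarith) hρ')
  -- From `exp (-p/2) ≥ 1 - p/2` and `e > 2` one gets `p + (1 - p) e ≤ exp (1 - p/2)`. The exponent
  -- is then `(1 - p/2) - (1 - p/4) = -p/4`.
  have hL' := hbound hL (by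
    have h1 : Real.log (1 - (1 - p) + (1 - p) * Real.exp 1) ≤ 1 - p / 2 := by
      have h3 : 0 < 1 - (1 - p) + (1 - p) * Real.exp 1 := by nlinarith
      rw [Real.log_le_iff_le_exp h3]
      have h4 : Real.exp (1 - p / 2) = Real.exp 1 * Real.exp (-(p / 2)) := by
        rw [← Real.exp_add]; ring_nf
      have h5 := Real.add_one_le_exp (-(p / 2))
      rw [h4]
      nlinarith
    have h2 : tL = (1 - p / 4) * (1 / ρ) := by simp only [tL]; ring
    rw [h2, hρ4, ← sub_mul]
    exact mul_le_mul_of_nonneg_right (by linarith) hρ')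
  have hL'' : ∑ Ω ∈ BL, drawWeight (1 - p) univ Ω =
      ∑ Ω ∈ univ.filter (fun Ω : Finset τ => Ωᶜ ∈ BL), drawWeight p univ Ω := by
    refine Finset.sum_nbij' compl compl ?_ ?_ ?_ ?_ ?_
    · intro Ω hΩ; simpa using hΩ
    · intro Ω hΩ; simpa using hΩ
    · intro Ω _; exact compl_compl Ω
    · intro Ω _; exact compl_compl Ω
    · intro Ω _
      rw [← drawWeight_compl p Ωᶜ, compl_compl]
  rw [hL''] at hL'
  have hw : ∀ S : Finset (Finset τ), 0 ≤ ∑ Ω ∈ S, drawWeight p univ Ω := fun S =>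
    Finset.sum_nonneg fun Ω _ => drawWeight_nonneg hp0 hp1 _ _
  have hunion := Finset.sum_union_inter (s₁ := BU)
    (s₂ := univ.filter fun Ω : Finset τ => Ωᶜ ∈ BL) (f := drawWeight p univ)
  -- An ill-conditioned `Ω` has a bad `x`; normalized, it witnesses one of the two tail events.
  have hsub : (univ.filter fun Ω : Finset τ => ¬ ∀ x : τ → ℝ, P *ᵥ x = x →
      p / 4 * fro x ^ 2 ≤ ∑ i ∈ Ω, x i ^ 2 ∧ ∑ i ∈ Ω, x i ^ 2 ≤ 2 * p * fro x ^ 2) ⊆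
      BU ∪ univ.filter fun Ω : Finset τ => Ωᶜ ∈ BL := by
    intro Ω hΩ
    by_contra hcon
    rw [Finset.mem_union, not_or] at hcon
    refine (Finset.mem_filter.1 hΩ).2 fun x hx => ?_
    by_cases hx0 : fro x = 0
    · have h1 := sq_fro x
      rw [hx0, zero_pow two_ne_zero] at h1
      have h2 : ∀ i, x i ^ 2 = 0 := fun i =>
        (Finset.sum_eq_zero_iff_of_nonneg fun _ _ => sq_nonneg _).1 h1.symm i (mem_univ i)
      simp [hx0, h2]
    have hxpos : 0 < fro x := lt_of_le_of_ne (fro_nonneg _) (Ne.symm hx0)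
    set u := (1 / fro x) • x
    have hu : u ⬝ᵥ u = 1 := by
      rw [smul_dotProduct, dotProduct_smul, ← sq_fro_eq_dotProduct, smul_eq_mul, smul_eq_mul]
      field_simp
    have hvu : ∀ i, (v i ⬝ᵥ u) ^ 2 = 1 / ρ * (x i ^ 2 / fro x ^ 2) := by
      intro i
      rw [hvx2, Matrix.mulVec_smul, hx, Pi.smul_apply, smul_eq_mul]
      ring
    have hsum : ∀ S : Finset τ, ∑ i ∈ S, (v i ⬝ᵥ u) ^ 2 =
        1 / ρ * ((∑ i ∈ S, x i ^ 2) / fro x ^ 2) := by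
      intro S
      simp only [hvu]
      rw [← Finset.mul_sum, ← Finset.sum_div]
    have hx2 : 0 < fro x ^ 2 := by positivity
    constructor
    · have h1 : Ωᶜ ∉ BL := fun h => hcon.2 (Finset.mem_filter.2 ⟨mem_univ _, h⟩)
      have h2 : ¬ tL ≤ ∑ i ∈ Ωᶜ, (v i ⬝ᵥ u) ^ 2 := fun h =>
        h1 (Finset.mem_filter.2 ⟨mem_univ _, u, hu, h⟩)
      rw [hsum, not_le, show tL = 1 / ρ * (1 - p / 4) by simp only [tL]; ring,
        mul_lt_mul_iff_right₀ (by positivity), div_lt_iff₀ hx2] at h2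
      have h3 := Finset.sum_add_sum_compl Ω fun i => x i ^ 2
      rw [← sq_fro] at h3
      linarith
    · have h1 : ¬ tU ≤ ∑ i ∈ Ω, (v i ⬝ᵥ u) ^ 2 := fun h =>
        hcon.1 (Finset.mem_filter.2 ⟨mem_univ _, u, hu, h⟩)
      rw [hsum, not_le, show tU = 1 / ρ * (2 * p) by simp only [tU]; ring,
        mul_lt_mul_iff_right₀ (by positivity), div_lt_iff₀ hx2] at h1
      exact h1.le
  have h1 := Finset.sum_le_sum_of_subset_of_nonneg hsub fun Ω _ _ =>
    drawWeight_nonneg hp0 hp1 univ Ω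
  have h2 := hw (BU ∩ univ.filter fun Ω : Finset τ => Ωᶜ ∈ BL)
  linarith

/-- The restriction to `Ω` is well conditioned on the range of `P`. -/
def WellSampled (P : Matrix τ τ ℝ) (p : ℝ) (Ω : Set τ) : Prop :=
  ∀ x : τ → ℝ, P *ᵥ x = x →
    p / 4 * fro x ^ 2 ≤ fro (mask Ω x) ^ 2 ∧ fro (mask Ω x) ^ 2 ≤ 2 * p * fro x ^ 2

/-- A union bound over singletons, so measurability of `B` plays no role. -/
theorem setBernoulli_le_sum_drawWeight (p : unitInterval) (B : Set (Set τ))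
    [DecidablePred fun Ω : Finset τ => (Ω : Set τ) ∈ B] :
    ProbabilityTheory.setBernoulli (Set.univ : Set τ) p B ≤
      ENNReal.ofReal (∑ Ω with ((Ω : Finset τ) : Set τ) ∈ B, drawWeight p univ Ω) := by
  have h1 : B ⊆ ⋃ Ω ∈ univ.filter (fun Ω : Finset τ => (Ω : Set τ) ∈ B), {(Ω : Set τ)} := by
    intro Ω hΩ
    classical
    simp only [Set.mem_iUnion, Set.mem_singleton_iff, exists_prop, Finset.mem_filter,
      Finset.mem_univ, true_and]
    exact ⟨Ω.toFinset, by simpa using hΩ, by simp⟩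
  refine (MeasureTheory.measure_mono h1).trans
    ((MeasureTheory.measure_biUnion_finset_le _ _).trans ?_)
  rw [ENNReal.ofReal_sum_of_nonneg fun Ω _ => drawWeight_nonneg p.2.1 p.2.2 _ _]
  refine Finset.sum_le_sum fun Ω _ => le_of_eq ?_
  rw [← ENNReal.ofReal_toReal (MeasureTheory.measure_ne_top _ _)]
  congr 1
  have h2 := ProbabilityTheory.setBernoulli_real_singleton p (Set.subset_univ (Ω : Set τ))
    Set.finite_univ
  rw [MeasureTheory.measureReal_def] at h2
  rw [h2, drawWeight, Set.ncard_coe_finset, ← Finset.coe_univ, ← Finset.coe_sdiff,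
    Set.ncard_coe_finset]

/-- Passing to the complement needs only subadditivity of the measure. -/
theorem setBernoulli_wellSampled_ge {P : Matrix τ τ ℝ} (hs : Pᵀ = P) (hi : P * P = P) {ρ : ℝ}
    (hρ : 0 < ρ) (hd : ∀ i, P i i ≤ ρ) (p : unitInterval) :
    ENNReal.ofReal (1 - 2 * (Fintype.card τ * Real.exp (-(p / (4 * ρ))))) ≤
      ProbabilityTheory.setBernoulli (Set.univ : Set τ) p {Ω | WellSampled P p Ω} := by
  classical
  set ν := ProbabilityTheory.setBernoulli (Set.univ : Set τ) p
  have h1 : (1 : ENNReal) ≤ ν {Ω | WellSampled P p Ω} + ν {Ω | WellSampled P p Ω}ᶜ := by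
    rw [← MeasureTheory.measure_univ (μ := ν), ← Set.union_compl_self {Ω | WellSampled P p Ω}]
    exact MeasureTheory.measure_union_le _ _
  have h2 : ν {Ω | WellSampled P p Ω}ᶜ ≤
      ENNReal.ofReal (2 * (Fintype.card τ * Real.exp (-(p / (4 * ρ))))) := by
    refine (setBernoulli_le_sum_drawWeight p _).trans (ENNReal.ofReal_le_ofReal ?_)
    refine le_trans (le_of_eq ?_) (sum_drawWeight_illConditioned_le hs hi hρ hd p.2.1 p.2.2)
    refine Finset.sum_congr (Finset.filter_congr fun Ω _ => ?_) fun _ _ => rfl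
    simp only [Set.mem_compl_iff, Set.mem_ofPred_eq, WellSampled, sq_fro_mask]
  rw [ENNReal.ofReal_sub _ (by positivity), ENNReal.ofReal_one]
  exact tsub_le_iff_right.2 (h1.trans (add_le_add le_rfl h2))

end Sampling

/-! ### Kronecker products of projections -/

section KronAll

variable {N : ℕ} {I : Fin N → ℕ}

/-- The Kronecker product of square matrices. -/
def kronAll (P : ∀ k, Matrix (Fin (I k)) (Fin (I k)) ℝ) : Matrix (Index I) (Index I) ℝ :=
  fun i j => ∏ k, P k (i k) (j k)

theorem kronAll_mulVec (P : ∀ k, Matrix (Fin (I k)) (Fin (I k)) ℝ) (X : Tensor I) :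
    kronAll P *ᵥ X = tucker X P := rfl

theorem kronAll_transpose {P : ∀ k, Matrix (Fin (I k)) (Fin (I k)) ℝ} (h : ∀ k, (P k)ᵀ = P k) :
    (kronAll P)ᵀ = kronAll P := by
  ext i j
  rw [Matrix.transpose_apply]
  exact Finset.prod_congr rfl fun k _ => congrFun (congrFun (h k) (i k)) (j k)

theorem kronAll_mul_self {P : ∀ k, Matrix (Fin (I k)) (Fin (I k)) ℝ} (h : ∀ k, P k * P k = P k) :
    kronAll P * kronAll P = kronAll P := by
  ext i j
  simp only [kronAll, Matrix.mul_apply, ← Finset.prod_mul_distrib]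
  rw [← Fintype.prod_sum (fun k (l : Fin (I k)) => P k (i k) l * P k l (j k))]
  refine Finset.prod_congr rfl fun k _ => ?_
  rw [← Matrix.mul_apply, h]

end KronAll

/-! ### Spectral bounds and canonical angles -/

section Angles

variable {m n l : Type*} [Fintype m] [Fintype n] [Fintype l]

theorem fro_eq_zero {x : m → ℝ} (hx : fro x = 0) : x = 0 := by
  rw [fro_eq_norm, norm_eq_zero] at hx
  exact congrArg WithLp.ofLp hx

theorem fro_transpose_mulVec_le {M : Matrix m n ℝ} {c : ℝ} (hc : 0 ≤ c)
    (h : ∀ x, fro (M *ᵥ x) ≤ c * fro x) (y : m → ℝ) : fro (Mᵀ *ᵥ y) ≤ c * fro y := by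
  have h1 : fro (Mᵀ *ᵥ y) ^ 2 ≤ c * fro y * fro (Mᵀ *ᵥ y) := by
    have h2 : fro (Mᵀ *ᵥ y) ^ 2 = y ⬝ᵥ M *ᵥ (Mᵀ *ᵥ y) := by
      rw [sq_fro_eq_dotProduct, Matrix.dotProduct_mulVec, Matrix.dotProduct_mulVec,
        Matrix.mulVec_transpose, ← Matrix.dotProduct_mulVec]
      rw [← Matrix.mulVec_transpose, dotProduct_comm]
    rw [h2]
    refine (le_abs_self _).trans ((abs_dotProduct_le _ _).trans ?_)
    have h3 := mul_le_mul_of_nonneg_left (h (Mᵀ *ᵥ y)) (fro_nonneg y)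
    linarith
  rcases (fro_nonneg (Mᵀ *ᵥ y)).eq_or_lt with h0 | h0
  · rw [← h0]; exact mul_nonneg hc (fro_nonneg _)
  · exact le_of_mul_le_mul_right (by rwa [sq] at h1) h0

section Proj

variable {P Q : Matrix m m ℝ}

theorem sq_fro_proj_add (hs : Pᵀ = P) (hi : P * P = P) (x : m → ℝ) :
    fro x ^ 2 = fro (P *ᵥ x) ^ 2 + fro (x - P *ᵥ x) ^ 2 := by
  have h : (P *ᵥ x) ⬝ᵥ (P *ᵥ x) = x ⬝ᵥ (P *ᵥ x) := by
    rw [Matrix.dotProduct_mulVec, Matrix.vecMul_mulVec, hs, hi, ← Matrix.mulVec_transpose, hs,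
      dotProduct_comm]
  simp only [sq_fro_eq_dotProduct, sub_dotProduct, dotProduct_sub, h]
  rw [dotProduct_comm (P *ᵥ x) x]
  ring

/-- The range of `P` receives `P (1 - Q)`, acting on the part of `z` orthogonal to `Q`; its
complement receives `-(1 - P) Q`, acting on `Q z`. Both splittings are orthogonal, so the two bounds
combine by Pythagoras without loss. -/
theorem fro_proj_sub_le [DecidableEq m] (hPs : Pᵀ = P) (hPi : P * P = P) (hQs : Qᵀ = Q)
    (hQi : Q * Q = Q) {c : ℝ} (hc : 0 ≤ c) (h1 : ∀ z, fro (((1 - P) * Q) *ᵥ z) ≤ c * fro z)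
    (h2 : ∀ z, fro (((1 - Q) * P) *ᵥ z) ≤ c * fro z) (z : m → ℝ) :
    fro ((P - Q) *ᵥ z) ≤ c * fro z := by
  rw [← sq_le_sq₀ (fro_nonneg _) (mul_nonneg hc (fro_nonneg _)), mul_pow,
    sq_fro_proj_add hPs hPi, sq_fro_proj_add hQs hQi z]
  have h3 : P *ᵥ (P - Q) *ᵥ z = ((1 - Q) * P)ᵀ *ᵥ (z - Q *ᵥ z) := by
    have h4 : P * (P - Q) = P * (1 - Q) * (1 - Q) := by
      have h10 : (1 - Q) * (1 - Q) = 1 - Q := by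
        rw [mul_sub, mul_one, sub_mul, hQi, one_mul, sub_self, sub_zero]
      rw [mul_assoc, h10, mul_sub, mul_sub, hPi, mul_one]
    have h5 : z - Q *ᵥ z = (1 - Q) *ᵥ z := by rw [Matrix.sub_mulVec, Matrix.one_mulVec]
    rw [h5, Matrix.mulVec_mulVec, Matrix.mulVec_mulVec, Matrix.transpose_mul,
      Matrix.transpose_sub, hPs, hQs, Matrix.transpose_one, h4]
  have h6 : (P - Q) *ᵥ z - P *ᵥ (P - Q) *ᵥ z = -(((1 - P) * Q) *ᵥ (Q *ᵥ z)) := by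
    rw [Matrix.mulVec_mulVec, Matrix.mulVec_mulVec, ← Matrix.sub_mulVec, ← Matrix.neg_mulVec,
      mul_assoc, hQi, mul_sub, hPi, sub_mul, one_mul]
    congr 1
    abel
  have h7 : fro (-(((1 - P) * Q) *ᵥ (Q *ᵥ z))) = fro (((1 - P) * Q) *ᵥ (Q *ᵥ z)) := by
    simp [fro]
  rw [h6, h7, h3]
  have h8 := pow_le_pow_left₀ (fro_nonneg _) (fro_transpose_mulVec_le hc h2 (z - Q *ᵥ z)) 2
  have h9 := pow_le_pow_left₀ (fro_nonneg _) (h1 (Q *ᵥ z)) 2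
  rw [mul_pow] at h8 h9
  linarith

end Proj

theorem transpose_mul_transpose_self {m : Type*} (A : Matrix m n ℝ) : (A * Aᵀ)ᵀ = A * Aᵀ := by
  rw [Matrix.transpose_mul, Matrix.transpose_transpose]

theorem isIdempotent_mul_transpose [DecidableEq n] {A : Matrix m n ℝ} (hA : Aᵀ * A = 1) :
    A * Aᵀ * (A * Aᵀ) = A * Aᵀ := by
  rw [Matrix.mul_assoc, ← Matrix.mul_assoc Aᵀ, hA, Matrix.one_mul]

/-- For range spaces of the same dimension the two one-sided gaps coincide. -/
theorem gap_symm [DecidableEq m] [DecidableEq n] {A B : Matrix m n ℝ} (hA : Aᵀ * A = 1)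
    (hB : Bᵀ * B = 1) {c : ℝ} (hc : 0 ≤ c)
    (h : ∀ z, fro (((1 - A * Aᵀ) * (B * Bᵀ)) *ᵥ z) ≤ c * fro z) (z : m → ℝ) :
    fro (((1 - B * Bᵀ) * (A * Aᵀ)) *ᵥ z) ≤ c * fro z := by
  have hPs := transpose_mul_transpose_self A
  have hPi := isIdempotent_mul_transpose hA
  have hQs := transpose_mul_transpose_self B
  have hQi := isIdempotent_mul_transpose hB
  set P := A * Aᵀ
  set Q := B * Bᵀ
  have hRs : (1 - Q)ᵀ = 1 - Q := by rw [Matrix.transpose_sub, hQs, Matrix.transpose_one]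
  have hRi : (1 - Q) * (1 - Q) = 1 - Q := by
    rw [mul_sub, mul_one, sub_mul, hQi, one_mul, sub_self, sub_zero]
  have hPz := fro_mulVec_le_of_proj hPs hPi z
  rw [← Matrix.mulVec_mulVec]
  set u := P *ᵥ z
  suffices hu : fro ((1 - Q) *ᵥ u) ≤ c * fro u from
    hu.trans (mul_le_mul_of_nonneg_left hPz hc)
  by_cases hc1 : 1 ≤ c
  · have h1 := fro_mulVec_le_of_proj hRs hRi u
    nlinarith [fro_nonneg u]
  push Not at hc1
  have hB' : ∀ w, Q *ᵥ (B *ᵥ w) = B *ᵥ w := fun w => by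
    rw [Matrix.mulVec_mulVec, Matrix.mul_assoc, hB, Matrix.mul_one]
  have hgap : ∀ w, fro (B *ᵥ w - P *ᵥ (B *ᵥ w)) ≤ c * fro (B *ᵥ w) := by
    intro w
    have h1 := h (B *ᵥ w)
    rwa [← Matrix.mulVec_mulVec, hB', Matrix.sub_mulVec, Matrix.one_mulVec] at h1
  -- For `c < 1` no nonzero vector of the range of `B` is orthogonal to the range of `A`. As `Aᵀ *
  -- B` is square, it is also surjective, so every `u` in the range of `A` is `P y` with `y` in the
  -- range of `B`.
  have hinj : Function.Injective (Matrix.toLin' (Aᵀ * B)) := by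
    rw [injective_iff_map_eq_zero]
    intro w hw
    rw [Matrix.toLin'_apply, ← Matrix.mulVec_mulVec] at hw
    have h1 := hgap w
    have h2 : P *ᵥ (B *ᵥ w) = 0 := by rw [← Matrix.mulVec_mulVec, hw, Matrix.mulVec_zero]
    rw [h2, sub_zero] at h1
    have h3 : fro (B *ᵥ w) = 0 := by nlinarith [fro_nonneg (B *ᵥ w)]
    rw [fro_mulVec_of_orthonormal hB] at h3
    exact fro_eq_zero h3
  obtain ⟨w, hw⟩ := (LinearMap.injective_iff_surjective.1 hinj) (Aᵀ *ᵥ z)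
  rw [Matrix.toLin'_apply, ← Matrix.mulVec_mulVec] at hw
  have huw : u = P *ᵥ (B *ᵥ w) := by
    rw [← Matrix.mulVec_mulVec (B *ᵥ w) A Aᵀ, hw, Matrix.mulVec_mulVec]
  set y := B *ᵥ w
  have hpyth := sq_fro_proj_add hPs hPi y
  rw [← huw] at hpyth
  have hgy := pow_le_pow_left₀ (fro_nonneg _) (hgap w) 2
  rw [← huw, mul_pow] at hgy
  change fro (y - u) ^ 2 ≤ c ^ 2 * fro y ^ 2 at hgy
  by_cases hy : fro y = 0
  · have : fro u = 0 := by nlinarith [fro_nonneg u, sq_nonneg (fro (y - u))]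
    rw [fro_eq_zero this, Matrix.mulVec_zero, fro_zero, mul_zero]
  have hy2 : 0 < fro y ^ 2 := by have := fro_nonneg y; positivity
  have huy : u ⬝ᵥ y = fro u ^ 2 := by
    have h1 : fro (y - u) ^ 2 = fro y ^ 2 - 2 * (u ⬝ᵥ y) + fro u ^ 2 := by
      simp only [sq_fro_eq_dotProduct, sub_dotProduct, dotProduct_sub]
      rw [dotProduct_comm y u]
      ring
    linarith
  -- The vector `t • y` is the orthogonal projection of `u` onto the line of `y`, because `u ⬝ᵥ y =
  -- fro u ^ 2`. It lies in the range of `Q`, and its squared distance to `u` is `(1 - t) * fro u ^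
  -- 2`.
  set t := fro u ^ 2 / fro y ^ 2
  have h1 : (1 - Q) *ᵥ u = (1 - Q) *ᵥ (u - t • y) := by
    rw [Matrix.mulVec_sub, Matrix.mulVec_smul, Matrix.sub_mulVec 1 Q y, hB', Matrix.one_mulVec,
      sub_self, smul_zero, sub_zero]
  have h2 : fro (u - t • y) ^ 2 = fro u ^ 2 - t * fro u ^ 2 := by
    have h3 : fro (u - t • y) ^ 2 = fro u ^ 2 - 2 * t * (u ⬝ᵥ y) + t ^ 2 * fro y ^ 2 := by
      simp only [sq_fro_eq_dotProduct, sub_dotProduct, dotProduct_sub, smul_dotProduct,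
        dotProduct_smul, smul_eq_mul]
      rw [dotProduct_comm y u]
      ring
    have h4 : t * fro y ^ 2 = fro u ^ 2 := div_mul_cancel₀ _ hy2.ne'
    rw [h3, huy]
    linear_combination t * h4
  have h5 : 1 - c ^ 2 ≤ t := by
    rw [le_div_iff₀ hy2]
    linarith
  rw [h1]
  refine (fro_mulVec_le_of_proj hRs hRi _).trans ?_
  rw [← sq_le_sq₀ (fro_nonneg _) (mul_nonneg hc (fro_nonneg _)), h2, mul_pow]
  nlinarith [sq_nonneg (fro u)]

theorem fro_mulVec_le_specNorm [DecidableEq n] (A : Matrix m n ℝ) (x : n → ℝ) :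
    fro (A *ᵥ x) ≤ specNorm A * fro x := by
  have h := (LinearMap.toContinuousLinearMap (Matrix.toEuclideanLin A)).le_opNorm
    (WithLp.toLp 2 x)
  rw [specNorm, fro_eq_norm, fro_eq_norm]
  exact h

theorem specNorm_nonneg [DecidableEq n] (A : Matrix m n ℝ) : 0 ≤ specNorm A := norm_nonneg _

theorem toEuclideanLin_mem_colSpace {m : Type*} [DecidableEq n] (A : Matrix m n ℝ) (x : n → ℝ) :
    WithLp.toLp 2 (A *ᵥ x) ∈ colSpace A := ⟨WithLp.toLp 2 x, rfl⟩

theorem exists_of_mem_colSpace {m : Type*} [DecidableEq n] {A : Matrix m n ℝ} {y : EuclideanSpace ℝ m} (hy : y ∈ colSpace A) :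
    ∃ x : n → ℝ, A *ᵥ x = WithLp.ofLp y := by
  obtain ⟨x, rfl⟩ := hy
  exact ⟨WithLp.ofLp x, rfl⟩

theorem starProjection_colSpace [DecidableEq n] {A : Matrix m n ℝ} (hA : Aᵀ * A = 1) (z : m → ℝ) :
    (colSpace A).starProjection (WithLp.toLp 2 z) = WithLp.toLp 2 ((A * Aᵀ) *ᵥ z) := by
  refine Submodule.eq_starProjection_of_mem_of_inner_eq_zero (K := colSpace A) ?_ ?_
  · rw [← Matrix.mulVec_mulVec]
    exact toEuclideanLin_mem_colSpace A _
  · intro w hw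
    obtain ⟨x, hx⟩ := exists_of_mem_colSpace hw
    have h : w = WithLp.toLp 2 (A *ᵥ x) := by rw [hx]
    rw [h, ← WithLp.toLp_sub, EuclideanSpace.inner_toLp_toLp, star_trivial, dotProduct_comm,
      Matrix.dotProduct_mulVec, ← Matrix.mulVec_transpose,
      Matrix.mulVec_sub, Matrix.mulVec_mulVec, ← Matrix.mul_assoc, hA, Matrix.one_mul, sub_self,
      zero_dotProduct]

theorem sinTheta_nonneg [DecidableEq n] [DecidableEq l] (X : Matrix m n ℝ) (Y : Matrix m l ℝ) : 0 ≤ sinTheta X Y := norm_nonneg _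

theorem fro_proj_sub_le_sinTheta [DecidableEq n] [DecidableEq l] {A : Matrix m n ℝ} {B : Matrix m l ℝ} (hA : Aᵀ * A = 1)
    (hB : Bᵀ * B = 1) (z : m → ℝ) :
    fro ((A * Aᵀ - B * Bᵀ) *ᵥ z) ≤ sinTheta A B * fro z := by
  have h := ((colSpace A).starProjection - (colSpace B).starProjection).le_opNorm
    (WithLp.toLp 2 z)
  rw [_root_.sub_apply, starProjection_colSpace hA, starProjection_colSpace hB,
    ← WithLp.toLp_sub, ← fro_eq_norm, ← fro_eq_norm, ← Matrix.sub_mulVec] at h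
  exact h

theorem sinTheta_le [DecidableEq n] [DecidableEq l] {A : Matrix m n ℝ} {B : Matrix m l ℝ} (hA : Aᵀ * A = 1)
    (hB : Bᵀ * B = 1) {c : ℝ} (hc : 0 ≤ c)
    (h : ∀ z, fro ((A * Aᵀ - B * Bᵀ) *ᵥ z) ≤ c * fro z) : sinTheta A B ≤ c := by
  refine ContinuousLinearMap.opNorm_le_bound _ hc fun z => ?_
  have h1 := h (WithLp.ofLp z)
  rw [Matrix.sub_mulVec, fro_eq_norm, WithLp.toLp_sub, ← starProjection_colSpace hA,
    ← starProjection_colSpace hB, ← _root_.sub_apply, fro_ofLp] at h1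
  exact h1

theorem sinTheta_congr_left [DecidableEq n] [DecidableEq l] {n' : Type*} [Fintype n']
    [DecidableEq n'] {A : Matrix m n ℝ} {A' : Matrix m n' ℝ} {B : Matrix m l ℝ} (hA : Aᵀ * A = 1)
    (hA' : A'ᵀ * A' = 1) (hB : Bᵀ * B = 1) (h : A * Aᵀ = A' * A'ᵀ) :
    sinTheta A B = sinTheta A' B :=
  le_antisymm
    (sinTheta_le hA hB (sinTheta_nonneg _ _) fun z => by
      rw [h]; exact fro_proj_sub_le_sinTheta hA' hB z)
    (sinTheta_le hA' hB (sinTheta_nonneg _ _) fun z => by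
      rw [← h]; exact fro_proj_sub_le_sinTheta hA hB z)

/-- A one-sided gap bounds the largest canonical angle. -/
theorem sinTheta_le_of_gap [DecidableEq m] [DecidableEq n] {A B : Matrix m n ℝ} (hA : Aᵀ * A = 1) (hB : Bᵀ * B = 1) {c : ℝ}
    (hc : 0 ≤ c) (h : ∀ z, fro (Bᵀ *ᵥ ((1 - A * Aᵀ) *ᵥ z)) ≤ c * fro z) : sinTheta A B ≤ c := by
  have h1 : ∀ z, fro (((1 - A * Aᵀ) * (B * Bᵀ)) *ᵥ z) ≤ c * fro z := by
    intro z
    have h2 : ∀ z, fro (((B * Bᵀ) * (1 - A * Aᵀ)) *ᵥ z) ≤ c * fro z := by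
      intro z
      rw [Matrix.mul_assoc, ← Matrix.mulVec_mulVec, fro_mulVec_of_orthonormal hB,
        ← Matrix.mulVec_mulVec]
      exact h z
    have h3 := fro_transpose_mulVec_le hc h2 z
    rwa [Matrix.transpose_mul, Matrix.transpose_sub, Matrix.transpose_one,
      transpose_mul_transpose_self, transpose_mul_transpose_self] at h3
  exact sinTheta_le hA hB hc (fro_proj_sub_le (transpose_mul_transpose_self A)
    (isIdempotent_mul_transpose hA) (transpose_mul_transpose_self B)
    (isIdempotent_mul_transpose hB) hc h1 (gap_symm hA hB hc h1))

theorem sinTheta_le_one [DecidableEq m] [DecidableEq n] {A B : Matrix m n ℝ} (hA : Aᵀ * A = 1)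
    (hB : Bᵀ * B = 1) : sinTheta A B ≤ 1 := by
  refine sinTheta_le_of_gap hA hB zero_le_one fun z => ?_
  have hs := transpose_mul_transpose_self A
  have hi := isIdempotent_mul_transpose hA
  have h1 : fro ((B * Bᵀ) *ᵥ ((1 - A * Aᵀ) *ᵥ z)) ≤ fro ((1 - A * Aᵀ) *ᵥ z) :=
    fro_mulVec_le_of_proj (transpose_mul_transpose_self B) (isIdempotent_mul_transpose hB) _
  rw [← Matrix.mulVec_mulVec, fro_mulVec_of_orthonormal hB] at h1
  have h2 := sq_fro_proj_add hs hi z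
  rw [one_mul]
  refine h1.trans ?_
  rw [Matrix.sub_mulVec, Matrix.one_mulVec, ← sq_le_sq₀ (fro_nonneg _) (fro_nonneg _)]
  nlinarith [sq_nonneg (fro ((A * Aᵀ) *ᵥ z))]

/-- The smallest singular value of a matrix of full row rank bounds its transpose from below. -/
theorem singMin_mul_fro_le [DecidableEq n] {a : ℕ} {G : Matrix (Fin a) n ℝ} (hr : G.rank = a) {g : ℝ}
    (hg0 : 0 < g) (hg : g ≤ singMin G) (x : Fin a → ℝ) : g * fro x ≤ fro (x ᵥ* G) := by
  set L := Matrix.toEuclideanLin G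
  -- Full row rank forces `a ≤ card n`, so `singMin` is the singular value of index `a - 1`, the
  -- last nonzero one.
  have hcard : a ≤ Fintype.card n := hr ▸ G.rank_le_card_width
  have hrange : Module.finrank ℝ L.range = a := by
    refine Eq.trans ?_ hr
    rw [Matrix.rank_eq_finrank_range_toLin G (EuclideanSpace.basisFun _ ℝ).toBasis
      (EuclideanSpace.basisFun _ ℝ).toBasis]
    rfl
  have hsurj : Function.Surjective L := by
    rw [← LinearMap.range_eq_top]
    refine Submodule.eq_top_of_finrank_eq ?_
    rw [hrange, finrank_euclideanSpace_fin]
  set S := LinearMap.adjoint L ∘ₗ L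
  have hS : S.IsSymmetric := L.isSymmetric_adjoint_comp_self
  set e := hS.eigenvectorBasis rfl
  have hsing : ∀ i : Fin (Module.finrank ℝ (EuclideanSpace ℝ n)), L.singularValues i ^ 2 = hS.eigenvalues rfl i :=
    fun i => L.sq_singularValues_fin rfl i
  have heig : ∀ i, S (e i) = (L.singularValues i ^ 2 : ℝ) • e i := by
    intro i
    rw [hsing]
    exact hS.apply_eigenvectorBasis rfl i
  have hbig : ∀ i : Fin (Module.finrank ℝ (EuclideanSpace ℝ n)), (i : ℕ) < a → g ≤ L.singularValues i := by
    intro i hi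
    refine hg.trans (L.singularValues_antitone ?_)
    rw [Fintype.card_fin, min_eq_left hcard]
    omega
  have hzero : ∀ i : Fin (Module.finrank ℝ (EuclideanSpace ℝ n)), a ≤ (i : ℕ) → L.singularValues i = 0 := by
    intro i hi
    rw [LinearMap.singularValues_eq_zero_iff_le_finrank_range, hrange]
    exact hi
  have hnormL : ∀ y, ‖L y‖ ^ 2 = inner ℝ (S y) y := by
    intro y
    rw [LinearMap.comp_apply, LinearMap.adjoint_inner_left, real_inner_self_eq_norm_sq]
  have hinner : ∀ y, inner ℝ (S y) y =
      ∑ i : Fin (Module.finrank ℝ (EuclideanSpace ℝ n)), L.singularValues i ^ 2 * (inner ℝ (e i) y) ^ 2 := by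
    intro y
    rw [← e.sum_inner_mul_inner]
    refine Finset.sum_congr rfl fun i _ => ?_
    rw [hS y (e i), heig, inner_smul_right, real_inner_comm]
    ring
  obtain ⟨y₀, hy₀⟩ := hsurj (WithLp.toLp 2 x)
  -- The preimage of `x` stripped of its kernel part: only right singular vectors with singular
  -- value at least `g` remain, so `g * ‖y‖ ≤ fro x`.
  set y := ∑ i : Fin (Module.finrank ℝ (EuclideanSpace ℝ n)), (if (i : ℕ) < a then inner ℝ (e i) y₀ else 0) • e i
  have hyc : ∀ i, inner ℝ (e i) y = if (i : ℕ) < a then inner ℝ (e i) y₀ else 0 := by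
    intro i
    exact e.orthonormal.inner_right_fintype _ i
  have hyx : L y = WithLp.toLp 2 x := by
    rw [← hy₀, ← sub_eq_zero, ← map_sub, ← norm_eq_zero, ← sq_eq_zero_iff, hnormL, hinner]
    refine Finset.sum_eq_zero fun i _ => ?_
    rw [inner_sub_right, hyc]
    split_ifs with hi
    · simp
    · rw [hzero i (not_lt.1 hi)]; simp
  have hxy : g ^ 2 * ‖y‖ ^ 2 ≤ fro x ^ 2 := by
    rw [fro_eq_norm, ← hyx, hnormL, hinner, ← e.sum_sq_norm_inner_right y, Finset.mul_sum]
    refine Finset.sum_le_sum fun i _ => ?_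
    rw [hyc]
    split_ifs with hi
    · rw [Real.norm_eq_abs, sq_abs]
      exact mul_le_mul_of_nonneg_right (pow_le_pow_left₀ hg0.le (hbig i hi) 2) (sq_nonneg _)
    · simp
  have hxy' : g * ‖y‖ ≤ fro x := by
    rw [← mul_pow] at hxy
    exact le_of_sq_le_sq hxy (fro_nonneg _)
  -- Duality turns the bound on a preimage under `G` into a lower bound for the transpose.
  have hdual : fro x ^ 2 ≤ fro (x ᵥ* G) * ‖y‖ := by
    have h1 : G *ᵥ WithLp.ofLp y = x := congrArg WithLp.ofLp hyx
    have h2 : fro x ^ 2 = (x ᵥ* G) ⬝ᵥ WithLp.ofLp y := by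
      rw [sq_fro_eq_dotProduct, ← Matrix.dotProduct_mulVec, h1]
    rw [h2, ← fro_ofLp y]
    exact (le_abs_self _).trans (abs_dotProduct_le _ _)
  rcases (fro_nonneg x).eq_or_lt with h0 | h0
  · rw [← h0, mul_zero]; exact fro_nonneg _
  · refine le_of_mul_le_mul_right ?_ h0
    nlinarith [fro_nonneg (x ᵥ* G), norm_nonneg y]

end Angles

/-! ### Angles between factors from distances between Tucker tensors -/

section TuckerAngles

variable {N : ℕ} {I r : Fin N → ℕ} {G : Tensor r} {A : ∀ n, Matrix (Fin (I n)) (Fin (r n)) ℝ}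

/-- A modal product of a Tucker tensor is bounded below by its action on the factor of that mode. -/
theorem mul_fro_le_fro_modeMul (hA : ∀ n, (A n)ᵀ * A n = 1) (k : Fin N)
    (hr : (unfold k G).rank = r k) {g : ℝ} (hg0 : 0 < g) (hg : g ≤ singMin (unfold k G))
    (M : Matrix (Fin (I k)) (Fin (I k)) ℝ) (z : Fin (I k) → ℝ) :
    g * fro ((A k)ᵀ *ᵥ (Mᵀ *ᵥ z)) ≤ fro z * fro (modeMul k M (tucker G A)) := by
  refine (singMin_mul_fro_le hr hg0 hg _).trans ?_
  have h := fro_vecMul_le z (unfold k (modeMul k M (tucker G A)))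
  rw [← fro_eq_unfold] at h
  refine le_trans (le_of_eq ?_) h
  rw [unfold_modeMul, unfold_tucker, ← Matrix.vecMul_vecMul, ← Matrix.vecMul_vecMul,
    ← Matrix.vecMul_vecMul, Matrix.vecMul_transpose,
    fro_mulVec_of_orthonormal (kronExcept_orthonormal k fun j _ => hA j), Matrix.mulVec_transpose,
    Matrix.mulVec_transpose]

/-- Tested with a column of the factor `A k`. It supplies `1 ≤ ‖T‖_F / g` for the constants. -/
theorem le_fro_tucker (hA : ∀ n, (A n)ᵀ * A n = 1) (k : Fin N) (hk : 0 < r k)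
    (hr : (unfold k G).rank = r k) {g : ℝ} (hg0 : 0 < g) (hg : g ≤ singMin (unfold k G)) :
    g ≤ fro (tucker G A) := by
  have h := mul_fro_le_fro_modeMul hA k hr hg0 hg 1 (A k *ᵥ Pi.single ⟨0, hk⟩ 1)
  have h1 : modeMul k 1 (tucker G A) = tucker G A := by
    rw [modeMul_tucker, Matrix.one_mul, Function.update_eq_self]
  have h2 : fro (Pi.single ⟨0, hk⟩ 1 : Fin (r k) → ℝ) = 1 := by
    simp [fro, Pi.single_apply]
  rw [h1, Matrix.transpose_one, Matrix.one_mulVec, Matrix.mulVec_mulVec, hA, Matrix.one_mulVec,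
    fro_mulVec_of_orthonormal (hA k), h2] at h
  linarith

/-- An approximation of a tensor with the factor `B` in mode `k` controls the angle between `B` and
the true factor. -/
theorem mul_sinTheta_le (hA : ∀ n, (A n)ᵀ * A n = 1) (k : Fin N)
    (hr : (unfold k G).rank = r k) {g : ℝ} (hg0 : 0 < g) (hg : g ≤ singMin (unfold k G))
    {d : Fin N → ℕ} (X : Tensor d) (B : ∀ n, Matrix (Fin (I n)) (Fin (d n)) ℝ)
    (C : Matrix (Fin (I k)) (Fin (r k)) ℝ) (hC : Cᵀ * C = 1) (hBC : C * Cᵀ * B k = B k) :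
    g * sinTheta C (A k) ≤ fro (tucker X B - tucker G A) := by
  have hsC := transpose_mul_transpose_self C
  have hiC := isIdempotent_mul_transpose hC
  have hMs : (1 - C * Cᵀ)ᵀ = 1 - C * Cᵀ := by
    rw [Matrix.transpose_sub, hsC, Matrix.transpose_one]
  have hMi : (1 - C * Cᵀ) * (1 - C * Cᵀ) = 1 - C * Cᵀ := by
    rw [mul_sub, mul_one, sub_mul, hiC, one_mul, sub_self, sub_zero]
  -- Projecting mode `k` onto the complement of the range of `C` annihilates the approximation and
  -- leaves precisely the part of `⟦G; A⟧` that detects the angle.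
  have h0 : modeMul k (1 - C * Cᵀ) (tucker X B) = 0 := by
    rw [modeMul_tucker, Matrix.sub_mul, hBC, Matrix.one_mul, sub_self, tucker_update_zero]
  have h1 : fro (modeMul k (1 - C * Cᵀ) (tucker G A)) ≤ fro (tucker X B - tucker G A) := by
    rw [fro_sub_rev]
    have h2 := fro_modeMul_le k zero_le_one
      (fun x => (fro_mulVec_le_of_proj hMs hMi x).trans (one_mul _).ge) (tucker G A - tucker X B)
    rwa [modeMul_sub, h0, sub_zero, one_mul] at h2
  rw [← le_div_iff₀' hg0]
  refine sinTheta_le_of_gap hC (hA k) (div_nonneg (fro_nonneg _) hg0.le) fun z => ?_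
  have h3 := mul_fro_le_fro_modeMul hA k hr hg0 hg (1 - C * Cᵀ) z
  rw [hMs] at h3
  rw [div_mul_eq_mul_div, le_div_iff₀' hg0]
  refine h3.trans ?_
  rw [mul_comm]
  exact mul_le_mul_of_nonneg_right h1 (fro_nonneg _)

/-- Each row of the mode-`n` unfolding of `⟦G; A⟧` lies in the range of the second matrix. Its
projection onto the range of the first is a combination of columns, whose coefficients form a row of
`Y`. Thus one free factor suffices to approximate the tensor up to the angle. -/
theorem exists_fro_tucker_sub_le {d : Fin N → ℕ} (H : Tensor d)
    (B : ∀ k, Matrix (Fin (I k)) (Fin (d k)) ℝ) (n : Fin N) :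
    ∃ Y : Matrix (Fin (I n)) (Fin (d n)) ℝ,
      fro (tucker H (Function.update B n Y) - tucker G A) ≤
        sinTheta (kronExcept n B * (unfold n H)ᵀ) (kronExcept n A * (unfold n G)ᵀ) *
          fro (tucker G A) := by
  set W := kronExcept n B * (unfold n H)ᵀ
  set V := kronExcept n A * (unfold n G)ᵀ
  set σ := sinTheta W V
  have hrow : ∀ i, unfold n (tucker G A) i = V *ᵥ A n i := by
    intro i
    rw [unfold_tucker, Matrix.mul_assoc, Matrix.mul_apply_eq_vecMul, ← Matrix.mulVec_transpose,
      Matrix.transpose_mul, Matrix.transpose_transpose]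
  have hex : ∀ i, ∃ y, W *ᵥ y =
      WithLp.ofLp ((colSpace W).starProjection (WithLp.toLp 2 (unfold n (tucker G A) i))) :=
    fun i => exists_of_mem_colSpace (Submodule.starProjection_apply_mem _ _)
  choose Y' hY using hex
  set Y : Matrix (Fin (I n)) (Fin (d n)) ℝ := Matrix.of Y'
  replace hY : ∀ i, W *ᵥ Y i = WithLp.ofLp
    ((colSpace W).starProjection (WithLp.toLp 2 (unfold n (tucker G A) i))) := hY
  refine ⟨Y, ?_⟩
  have hrow' : ∀ i, unfold n (tucker H (Function.update B n Y)) i = W *ᵥ Y i := by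
    intro i
    rw [unfold_tucker, Function.update_self,
      kronExcept_congr n (B := B) fun k hk => Function.update_of_ne hk _ _, Matrix.mul_assoc,
      Matrix.mul_apply_eq_vecMul, ← Matrix.mulVec_transpose, Matrix.transpose_mul,
      Matrix.transpose_transpose]
  have hbound : ∀ i, fro (W *ᵥ Y i - unfold n (tucker G A) i) ≤
      σ * fro (unfold n (tucker G A) i) := by
    intro i
    rw [hY]
    set t := WithLp.toLp 2 (unfold n (tucker G A) i)
    have h1 : (colSpace V).starProjection t = t := by
      rw [Submodule.starProjection_eq_self_iff, show t = WithLp.toLp 2 (V *ᵥ A n i) by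
        rw [← hrow]]
      exact toEuclideanLin_mem_colSpace _ _
    have h2 := ((colSpace W).starProjection - (colSpace V).starProjection).le_opNorm t
    rw [_root_.sub_apply, h1] at h2
    rw [fro_eq_norm, fro_eq_norm (unfold n (tucker G A) i)]
    exact h2
  have hσ : 0 ≤ σ := sinTheta_nonneg _ _
  rw [← sq_le_sq₀ (fro_nonneg _) (mul_nonneg hσ (fro_nonneg _)), mul_pow, sq_fro_eq_unfold n,
    sq_fro_eq_unfold n, Finset.mul_sum]
  refine Finset.sum_le_sum fun i _ => ?_
  have h := pow_le_pow_left₀ (fro_nonneg _) (hbound i) 2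
  rw [mul_pow, sq_fro, sq_fro, ← hrow'] at h
  exact h

/-- Closeness of the unfoldings along one mode controls the angles in all the other modes. -/
theorem mul_sinTheta_le_of_kronExcept (hA : ∀ n, (A n)ᵀ * A n = 1) {n k : Fin N} (hnk : k ≠ n)
    (hr : (unfold k G).rank = r k) {g : ℝ} (hg0 : 0 < g) (hg : g ≤ singMin (unfold k G))
    (H : Tensor r) (B : ∀ k, Matrix (Fin (I k)) (Fin (r k)) ℝ) (hB : (B k)ᵀ * B k = 1) :
    g * sinTheta (B k) (A k) ≤
      sinTheta (kronExcept n B * (unfold n H)ᵀ) (kronExcept n A * (unfold n G)ᵀ) *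
        fro (tucker G A) := by
  obtain ⟨Y, hY⟩ := exists_fro_tucker_sub_le (G := G) (A := A) H B n
  refine (mul_sinTheta_le hA k hr hg0 hg H (Function.update B n Y) (B k) hB ?_).trans hY
  rw [Function.update_of_ne hnk, Matrix.mul_assoc, hB, Matrix.mul_one]

/-- Multiplying the unfolding by `(A n)ᵀ` preserves its Frobenius norm and leaves `r n` rows, each
the image of a unit vector. -/
theorem fro_tucker_le_sqrt_mul_specNorm (hA : ∀ n, (A n)ᵀ * A n = 1) (n : Fin N) :
    fro (tucker G A) ≤ √(r n) * specNorm (unfold n (tucker G A)) := by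
  set U := unfold n (tucker G A)
  have h0 := specNorm_nonneg U
  have hcol : ∀ c, ∑ i, U i c ^ 2 = ∑ a, ((A n)ᵀ * U) a c ^ 2 := by
    intro c
    set v : Fin (r n) → ℝ := fun a => (unfold n G * (kronExcept n A)ᵀ) a c
    have h1 : (fun i => U i c) = A n *ᵥ v := by
      funext i
      simp only [U]
      rw [unfold_tucker, Matrix.mul_assoc]
      rfl
    have h2 : (fun a => ((A n)ᵀ * U) a c) = v := by
      funext a
      simp only [U]
      rw [unfold_tucker, Matrix.mul_assoc, ← Matrix.mul_assoc (A n)ᵀ, hA, Matrix.one_mul]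
    have h3 := congrArg (· ^ 2) (fro_mulVec_of_orthonormal (hA n) v)
    simp only [← h1, sq_fro] at h3
    rw [h3, ← h2]
  rw [← sq_le_sq₀ (fro_nonneg _) (mul_nonneg (Real.sqrt_nonneg _) h0), mul_pow,
    Real.sq_sqrt (Nat.cast_nonneg _), sq_fro_eq_unfold n, Finset.sum_comm]
  change ∑ c, ∑ i, U i c ^ 2 ≤ _
  simp only [hcol]
  rw [Finset.sum_comm]
  have hrow : ∀ a, ∑ c, ((A n)ᵀ * U) a c ^ 2 ≤ specNorm U ^ 2 := by
    intro a
    have h1 := fro_transpose_mulVec_le h0 (fro_mulVec_le_specNorm U) ((A n)ᵀ a)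
    have h2 : fro ((A n)ᵀ a) = 1 := by
      have h3 := sq_fro_eq_dotProduct ((A n)ᵀ a)
      have h4 : (A n)ᵀ a ⬝ᵥ (A n)ᵀ a = 1 := by
        have := congrFun (congrFun (hA n) a) a
        rw [Matrix.one_apply_eq] at this
        exact this
      rw [h4] at h3
      nlinarith [fro_nonneg ((A n)ᵀ a)]
    rw [h2, mul_one, Matrix.mulVec_transpose] at h1
    have h5 := pow_le_pow_left₀ (fro_nonneg _) h1 2
    rw [sq_fro] at h5
    exact h5
  refine (Finset.sum_le_sum fun a _ => hrow a).trans ?_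
  simp

end TuckerAngles

/-! ### The sampled residual near the true factors -/

section Residual

variable {N : ℕ} {I r : Fin N → ℕ} {G : Tensor r} {A : ∀ n, Matrix (Fin (I n)) (Fin (r n)) ℝ}

/-- The orthogonal projections onto the ranges of the factors, except for the mode `i₀`. -/
def projExcept (i₀ : Fin N) (A : ∀ n, Matrix (Fin (I n)) (Fin (r n)) ℝ) (k : Fin N) :
    Matrix (Fin (I k)) (Fin (I k)) ℝ :=
  if k = i₀ then 1 else A k * (A k)ᵀ

theorem projExcept_transpose (i₀ : Fin N) (A : ∀ n, Matrix (Fin (I n)) (Fin (r n)) ℝ) (k : Fin N) :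
    (projExcept i₀ A k)ᵀ = projExcept i₀ A k := by
  unfold projExcept
  split_ifs
  · exact Matrix.transpose_one
  · exact transpose_mul_transpose_self _

theorem projExcept_mul_self (hA : ∀ n, (A n)ᵀ * A n = 1) (i₀ k : Fin N) :
    projExcept i₀ A k * projExcept i₀ A k = projExcept i₀ A k := by
  unfold projExcept
  split_ifs
  · exact Matrix.one_mul 1
  · exact isIdempotent_mul_transpose (hA k)

theorem projExcept_mul (hA : ∀ n, (A n)ᵀ * A n = 1) (i₀ k : Fin N) :
    projExcept i₀ A k * A k = A k := by
  unfold projExcept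
  split_ifs
  · exact Matrix.one_mul _
  · rw [Matrix.mul_assoc, hA, Matrix.mul_one]

theorem tucker_projExcept_self (hA : ∀ n, (A n)ᵀ * A n = 1) (i₀ : Fin N) (X : Tensor r) :
    tucker (tucker X A) (projExcept i₀ A) = tucker X A := by
  rw [tucker_tucker]
  simp only [projExcept_mul hA]

theorem fro_projExcept_le (hA : ∀ n, (A n)ᵀ * A n = 1) (i₀ k : Fin N) (x : Fin (I k) → ℝ) :
    fro (projExcept i₀ A k *ᵥ x) ≤ fro x :=
  fro_mulVec_le_of_proj (projExcept_transpose i₀ A k) (projExcept_mul_self hA i₀ k) x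

theorem fro_tucker_projExcept_sub_le {B : ∀ n, Matrix (Fin (I n)) (Fin (r n)) ℝ}
    (hA : ∀ n, (A n)ᵀ * A n = 1) (hB : ∀ n, (B n)ᵀ * B n = 1) {i₀ : Fin N} {c : ℝ} (hc : 0 ≤ c)
    (h : ∀ k, k ≠ i₀ → sinTheta (A k) (B k) ≤ c) (X : Tensor I) :
    fro (tucker X (projExcept i₀ A) - tucker X (projExcept i₀ B)) ≤ N * c * fro X := by
  have h1 := fro_tucker_sub_tucker_le X (δ := fun _ => c) (fun _ => hc)
    (fro_projExcept_le hA i₀) (fro_projExcept_le hB i₀) fun k x => ?_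
  · simpa using h1
  · unfold projExcept
    split_ifs with hk
    · rw [sub_self, Matrix.zero_mulVec, fro_zero]
      exact mul_nonneg hc (fro_nonneg _)
    · exact (fro_proj_sub_le_sinTheta (hA k) (hB k) x).trans
        (mul_le_mul_of_nonneg_right (h k hk) (fro_nonneg _))

theorem sinTheta_comm {m n l : Type*} [Fintype m] [Fintype n] [Fintype l] [DecidableEq n]
    [DecidableEq l] (X : Matrix m n ℝ) (Y : Matrix m l ℝ) : sinTheta X Y = sinTheta Y X :=
  norm_sub_rev _ _

/-- The sampled residual is equivalent to the full one, provided the factors of all the modes but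
one are very close to the true ones. -/
theorem sampled_residual_bounds {B A' : ∀ n, Matrix (Fin (I n)) (Fin (r n)) ℝ}
    (hA : ∀ n, (A n)ᵀ * A n = 1) (hB : ∀ n, (B n)ᵀ * B n = 1) (hA' : ∀ n, (A' n)ᵀ * A' n = 1)
    {i₀ : Fin N} {q s g p : ℝ} (hq0 : 0 ≤ q) (hs0 : 0 ≤ s) (hs1 : s ≤ 1)
    (hp0 : 0 ≤ p) (hp1 : p ≤ 1)
    (hBA : ∀ k, k ≠ i₀ → sinTheta (B k) (A k) ≤ q * s)
    (hA'A : ∀ k, k ≠ i₀ → sinTheta (A' k) (A k) ≤ q)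
    (hq : N * q ≤ √p / 80) (hqT : N * q * fro (tucker G A) ≤ √p / 80 * g)
    {Ω : Set (Index I)} (hΩ : WellSampled (kronAll (projExcept i₀ A')) p Ω) (X : Tensor r)
    (hgs : g * s ≤ fro (tucker X B - tucker G A)) :
    2 / 5 * √p * fro (tucker X B - tucker G A) ≤ fro (mask Ω (tucker X B - tucker G A)) ∧
      fro (mask Ω (tucker X B - tucker G A)) ≤ 8 / 5 * √p * fro (tucker X B - tucker G A) := by
  set T := tucker G A
  set Z := tucker X B
  set D := fro (Z - T)
  set x := √p
  have hx0 : 0 ≤ x := Real.sqrt_nonneg p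
  have hx1 : x ≤ 1 := Real.sqrt_le_one.2 hp1
  have hD0 : 0 ≤ D := fro_nonneg _
  set PZ := tucker Z (projExcept i₀ A)
  set Y := PZ - T
  set Y' := tucker Y (projExcept i₀ A')
  -- Replacing the projections for `B` by those for `A` costs `N q s ‖Z‖`. As `g * s ≤ D`, this is
  -- an error relative to `D` even though `Z` itself is not small.
  have hZ : fro (Z - PZ) ≤ x / 40 * D := by
    have h1 := fro_tucker_projExcept_sub_le hB hA (mul_nonneg hq0 hs0) hBA Z
    rw [tucker_projExcept_self hB] at h1
    have h2 : fro Z ≤ D + fro T := by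
      have := fro_add_le (Z - T) T
      rwa [sub_add_cancel] at this
    have hN : 0 ≤ (N : ℝ) * q := mul_nonneg (Nat.cast_nonneg _) hq0
    have h3 : N * (q * s) * fro Z ≤ N * q * s * D + N * q * fro T * s := by
      have := mul_le_mul_of_nonneg_left h2 (mul_nonneg hN hs0)
      linarith
    have h4 : N * q * s * D ≤ x / 80 * D := by
      refine mul_le_mul_of_nonneg_right ?_ hD0
      exact (mul_le_of_le_one_right hN hs1).trans hq
    have h5 : N * q * fro T * s ≤ x / 80 * D := by
      have h6 := mul_le_mul_of_nonneg_right hqT hs0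
      have h7 := mul_le_mul_of_nonneg_left hgs (by positivity : 0 ≤ x / 80)
      linarith
    linarith
  have hYP : tucker Y (projExcept i₀ A) = Y := by
    have h1 : tucker PZ (projExcept i₀ A) = PZ := by
      simp only [PZ]
      rw [tucker_tucker]
      simp only [projExcept_mul_self hA]
    simp only [Y]
    rw [tucker_sub, h1, tucker_projExcept_self hA]
  -- The reference factors are only within `q`, not `q * s`, of the truth. This suffices because
  -- here the error is relative to the difference tensor `Y`.
  have hY' : fro (Y - Y') ≤ x / 80 * fro Y := by
    have h1 := fro_tucker_projExcept_sub_le hA hA' hq0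
      (fun k hk => (sinTheta_comm _ _).trans_le (hA'A k hk)) Y
    rw [hYP] at h1
    exact h1.trans (mul_le_mul_of_nonneg_right hq (fro_nonneg _))
  have hfix : kronAll (projExcept i₀ A') *ᵥ Y' = Y' := by
    simp only [Y']
    rw [kronAll_mulVec, tucker_tucker]
    simp only [projExcept_mul_self hA']
  obtain ⟨hlo, hhi⟩ := hΩ Y' hfix
  have hlo' : x / 2 * fro Y' ≤ fro (mask Ω Y') := by
    refine le_of_sq_le_sq ?_ (fro_nonneg _)
    rw [mul_pow, div_pow, Real.sq_sqrt hp0]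
    norm_num
    exact hlo
  -- Uses `√2 ≤ 3/2`.
  have hhi' : fro (mask Ω Y') ≤ 3 / 2 * x * fro Y' := by
    refine le_of_sq_le_sq (hhi.trans ?_) (by have := fro_nonneg Y'; positivity)
    rw [mul_pow, mul_pow, Real.sq_sqrt hp0]
    have := mul_nonneg hp0 (sq_nonneg (fro Y'))
    linarith
  have hYD : Z - T = Y + (Z - PZ) := by simp only [Y]; abel
  have hYD' : Y = (Z - T) - (Z - PZ) := by simp only [Y]; abel
  have hY'Y : Y' = Y - (Y - Y') := by abel
  have hYY' : Y = Y' + (Y - Y') := by abel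
  have e1 : fro Y ≤ D + fro (Z - PZ) := by
    conv_lhs => rw [hYD']
    exact fro_sub_le _ _
  have e2 : D ≤ fro Y + fro (Z - PZ) := by
    change fro (Z - T) ≤ _
    conv_lhs => rw [hYD]
    exact fro_add_le _ _
  have e3 : fro Y ≤ fro Y' + fro (Y - Y') := by
    conv_lhs => rw [hYY']
    exact fro_add_le _ _
  have e4 : fro Y' ≤ fro Y + fro (Y - Y') := by
    conv_lhs => rw [hY'Y]
    exact fro_sub_le _ _
  -- Perturbations are not controlled by the sampling and enter with their full norm. This is why
  -- they must be small compared with `√p`.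
  have hmask : ∀ U V : Tensor I, fro (mask Ω (U + V)) ≤ fro (mask Ω U) + fro V := by
    intro U V
    rw [mask_add]
    exact (fro_add_le _ _).trans (add_le_add le_rfl (fro_mask_le _ _))
  have e5 : fro (mask Ω (Z - T)) ≤ fro (mask Ω Y) + fro (Z - PZ) := by
    rw [hYD]; exact hmask _ _
  have e6 : fro (mask Ω Y) ≤ fro (mask Ω Y') + fro (Y - Y') := by
    conv_lhs => rw [hYY']
    exact hmask _ _
  have e7 : fro (mask Ω Y) ≤ fro (mask Ω (Z - T)) + fro (Z - PZ) := by
    have h1 := hmask (Z - T) (PZ - Z)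
    rw [fro_sub_rev PZ Z] at h1
    have h2 : Y = Z - T + (PZ - Z) := by simp only [Y]; abel
    rwa [← h2] at h1
  have e8 : fro (mask Ω Y') ≤ fro (mask Ω Y) + fro (Y - Y') := by
    have h1 := hmask Y (Y' - Y)
    rw [fro_sub_rev Y' Y] at h1
    have h2 : Y' = Y + (Y' - Y) := by abel
    rwa [← h2] at h1
  have hxD : x * D ≤ D := mul_le_of_le_one_left hD0 hx1
  have f1 : fro Y ≤ 41 / 40 * D := by linarith
  have f2 : 39 / 40 * D ≤ fro Y := by linarith
  have f3 : x / 80 * fro Y ≤ x / 80 * (41 / 40 * D) :=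
    mul_le_mul_of_nonneg_left f1 (by positivity)
  have f4 : fro Y' ≤ (41 / 40 + 41 / 3200) * D := by linarith
  have f5 : (39 / 40 - 41 / 3200) * D ≤ fro Y' := by linarith
  have f6 := mul_le_mul_of_nonneg_left f4 (by positivity : 0 ≤ 3 / 2 * x)
  have f7 := mul_le_mul_of_nonneg_left f5 (by positivity : 0 ≤ x / 2)
  have hxD0 : 0 ≤ x * D := mul_nonneg hx0 hD0
  constructor <;> linarith

theorem obsResidual_nonneg {d : Fin N → ℕ} (Ω : Set (Index I)) (T : Tensor I) (X : Tensor d)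
    (B : ∀ n, Matrix (Fin (I n)) (Fin (d n)) ℝ) : 0 ≤ obsResidual Ω T X B := fro_nonneg _

theorem minObsResidual_le {d : Fin N → ℕ} (Ω : Set (Index I)) (T : Tensor I) (X : Tensor d)
    (B : ∀ n, Matrix (Fin (I n)) (Fin (d n)) ℝ) : minObsResidual Ω T B ≤ obsResidual Ω T X B :=
  ciInf_le ⟨0, by rintro _ ⟨Y, rfl⟩; exact obsResidual_nonneg Ω T Y B⟩ X

/-- The competitor core for the upper bound: the projection of the true tensor onto the ranges of
the `B n`. Projecting onto the ranges of the `A n` changes nothing, so telescoping applies. -/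
theorem fro_tucker_sub_proj_le {B : ∀ n, Matrix (Fin (I n)) (Fin (r n)) ℝ}
    (hA : ∀ n, (A n)ᵀ * A n = 1) (hB : ∀ n, (B n)ᵀ * B n = 1) {c : ℝ} (hc : 0 ≤ c)
    (h : ∀ k, sinTheta (B k) (A k) ≤ c) :
    fro (tucker (tucker (tucker G A) fun n => (B n)ᵀ) B - tucker G A) ≤
      N * c * fro (tucker G A) := by
  have h1 := fro_tucker_sub_tucker_le (tucker G A) (B := fun n => B n * (B n)ᵀ)
    (C := fun n => A n * (A n)ᵀ) (δ := fun _ => c) (fun _ => hc)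
    (fun n => fro_mulVec_le_of_proj (transpose_mul_transpose_self _)
      (isIdempotent_mul_transpose (hB n)))
    (fun n => fro_mulVec_le_of_proj (transpose_mul_transpose_self _)
      (isIdempotent_mul_transpose (hA n)))
    (fun k x => (fro_proj_sub_le_sinTheta (hB k) (hA k) x).trans
        (mul_le_mul_of_nonneg_right (h k) (fro_nonneg _)))
  have h2 : tucker (tucker G A) (fun n => A n * (A n)ᵀ) = tucker G A := by
    rw [tucker_tucker]
    congr 1
    funext n
    rw [Matrix.mul_assoc, hA, Matrix.mul_one]
  rw [h2] at h1
  rw [tucker_tucker]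
  simpa using h1

/-- Two-sided control of the best sampled residual and of the sampled residual of any core. -/
theorem residual_comparison {d : Fin N → ℕ} (hd : d = r)
    {B : ∀ n, Matrix (Fin (I n)) (Fin (d n)) ℝ} {A' : ∀ n, Matrix (Fin (I n)) (Fin (r n)) ℝ}
    (hA : ∀ n, (A n)ᵀ * A n = 1) (hB : ∀ n, (B n)ᵀ * B n = 1) (hA' : ∀ n, (A' n)ᵀ * A' n = 1)
    {i₀ : Fin N} {q s g p : ℝ} (hq0 : 0 ≤ q) (hp0 : 0 ≤ p) (hp1 : p ≤ 1)
    (hr : ∀ k, (unfold k G).rank = r k) (hg0 : 0 < g) (hg : ∀ k, g ≤ singMin (unfold k G))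
    (hs : s = ⨆ k, sinTheta (B k) (A k))
    (hBA : ∀ k, k ≠ i₀ → sinTheta (B k) (A k) ≤ q * s)
    (hA'A : ∀ k, k ≠ i₀ → sinTheta (A' k) (A k) ≤ q)
    (hq : N * q ≤ √p / 80) (hqT : N * q * fro (tucker G A) ≤ √p / 80 * g)
    {Ω : Set (Index I)} (hΩ : WellSampled (kronAll (projExcept i₀ A')) p Ω) :
    (∀ X, 2 / 5 * √p * fro (tucker X B - tucker G A) ≤ obsResidual Ω (tucker G A) X B ∧
      obsResidual Ω (tucker G A) X B ≤ 8 / 5 * √p * fro (tucker X B - tucker G A)) ∧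
    2 / 5 * √p * (g * s) ≤ minObsResidual Ω (tucker G A) B ∧
    minObsResidual Ω (tucker G A) B ≤ 8 / 5 * √p * (N * s * fro (tucker G A)) := by
  subst hd
  have hle : ∀ k, sinTheta (B k) (A k) ≤ s := fun k => by
    rw [hs]; exact le_ciSup (f := fun k => sinTheta (B k) (A k)) (Set.finite_range _).bddAbove k
  have : Nonempty (Fin N) := ⟨i₀⟩
  have hs0 : 0 ≤ s := (sinTheta_nonneg _ _).trans (hle i₀)
  have hs1 : s ≤ 1 := by rw [hs]; exact ciSup_le fun k => sinTheta_le_one (hB k) (hA k)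
  have hgs : ∀ X, g * s ≤ fro (tucker X B - tucker G A) := by
    intro X
    rw [← le_div_iff₀' hg0, hs]
    refine ciSup_le fun k => (le_div_iff₀' hg0).2 ?_
    refine mul_sinTheta_le hA k (hr k) hg0 (hg k) X B (B k) (hB k) ?_
    rw [Matrix.mul_assoc, hB, Matrix.mul_one]
  have hbd := fun X => sampled_residual_bounds (G := G) hA hB hA' hq0 hs0 hs1 hp0 hp1 hBA hA'A hq
    hqT hΩ X (hgs X)
  refine ⟨hbd, le_ciInf fun X => ?_, ?_⟩
  · exact (mul_le_mul_of_nonneg_left (hgs X) (by positivity)).trans (hbd X).1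
  · refine (minObsResidual_le Ω _ (tucker (tucker G A) fun n => (B n)ᵀ) B).trans
      ((hbd _).2.trans (mul_le_mul_of_nonneg_left ?_ (by positivity)))
    exact fro_tucker_sub_proj_le hA hB hs0 hle

/-- For iterates, whose sizes equal `r` only propositionally. -/
theorem mul_sinTheta_le_of_eq {d : Fin N → ℕ} (hd : d = r) (hA : ∀ n, (A n)ᵀ * A n = 1)
    {n k : Fin N} (hnk : k ≠ n)
    (hr : (unfold k G).rank = r k) {g : ℝ} (hg0 : 0 < g) (hg : g ≤ singMin (unfold k G))
    (H : Tensor d) (B : ∀ k, Matrix (Fin (I k)) (Fin (d k)) ℝ) (hB : (B k)ᵀ * B k = 1) :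
    g * sinTheta (B k) (A k) ≤
      sinTheta (kronExcept n B * (unfold n H)ᵀ) (kronExcept n A * (unfold n G)ᵀ) *
        fro (tucker G A) := by
  subst hd
  exact mul_sinTheta_le_of_kronExcept hA hnk hr hg0 hg H B hB

/-- If all singular vectors are kept, truncation is a change of orthonormal basis. -/
theorem IsTruncatedLeftSingular.orthogonal {a b : ℕ} {c : Type*} [Fintype c] [DecidableEq c]
    {κ : ℝ} {G : Matrix (Fin a) c ℝ} {U : Matrix (Fin a) (Fin b) ℝ}
    (h : IsTruncatedLeftSingular κ G U) (hab : b = a) : Uᵀ * U = 1 ∧ U * Uᵀ = 1 := by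
  subst hab
  obtain ⟨-, V, hV, -, hle, rfl⟩ := h
  have h1 : V.submatrix id (Fin.castLE hle) = V := rfl
  rw [h1]
  exact ⟨hV, mul_eq_one_comm.1 hV⟩

end Residual

/-! ### Linear convergence of a run on a well-sampled index set -/

section RunConvergence

variable {N K M : ℕ} {I r : Fin N → ℕ} {D : Diagram N K M} {Ω : Set (Index I)} {κ : Fin N → ℝ}
  {G : Tensor r} {A : ∀ n, Matrix (Fin (I n)) (Fin (r n)) ℝ}

theorem abs_le_fro {ι : Type*} [Fintype ι] (X : ι → ℝ) (i : ι) : |X i| ≤ fro X := by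
  rw [← Real.sqrt_sq_eq_abs]
  exact Real.sqrt_le_sqrt
    (Finset.single_le_sum (f := fun i => X i ^ 2) (fun _ _ => sq_nonneg _) (Finset.mem_univ i))

theorem tendsto_of_fro_sub_tendsto_zero {ι : Type*} [Fintype ι] {X : ℕ → ι → ℝ} {Y : ι → ℝ}
    (h : Filter.Tendsto (fun t => fro (X t - Y)) Filter.atTop (nhds 0)) :
    Filter.Tendsto X Filter.atTop (nhds Y) := by
  rw [tendsto_pi_nhds]
  intro i
  rw [tendsto_iff_norm_sub_tendsto_zero]
  exact squeeze_zero (fun _ => norm_nonneg _) (fun t => abs_le_fro (X t - Y) i) h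

namespace Run

variable {T : Tensor I}

theorem Q_orthonormal (run : Run D Ω T κ) (t : ℕ) (n : Fin N) :
    (run.Q t n)ᵀ * run.Q t n = 1 := by
  obtain ⟨X, -, -, h, -⟩ := run.factor_update t n
  exact h

theorem U_orthogonal (run : Run D Ω T κ) (hrk : ∀ t n, run.rk t n = r n) (t : ℕ) (n : Fin N) :
    (run.U t n)ᵀ * run.U t n = 1 ∧ run.U t n * (run.U t n)ᵀ = 1 :=
  (run.truncation t n).orthogonal (by rw [hrk, hrk])

theorem A_orthonormal (run : Run D Ω T κ) (hrk : ∀ t n, run.rk t n = r n) (t : ℕ) (n : Fin N) :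
    (run.A t n)ᵀ * run.A t n = 1 := by
  cases t with
  | zero => exact run.orthonormal_init n
  | succ t =>
    rw [run.factor_succ, Matrix.transpose_mul, Matrix.mul_assoc, ← Matrix.mul_assoc (run.Q t n)ᵀ,
      run.Q_orthonormal, Matrix.one_mul, (run.U_orthogonal hrk t n).1]

/-- With unchanged ranks, the rank reduction does not alter the range of the factor, so angles may
be computed from `Q`. -/
theorem A_succ_mul_transpose (run : Run D Ω T κ) (hrk : ∀ t n, run.rk t n = r n) (t : ℕ)
    (n : Fin N) : run.A (t + 1) n * (run.A (t + 1) n)ᵀ = run.Q t n * (run.Q t n)ᵀ := by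
  rw [run.factor_succ, Matrix.transpose_mul, Matrix.mul_assoc, ← Matrix.mul_assoc (run.U t n),
    (run.U_orthogonal hrk t n).2, Matrix.one_mul]

theorem sinAngle_nonneg (run : Run D Ω T κ) (t : ℕ) : 0 ≤ run.sinAngle A t :=
  Real.iSup_nonneg fun _ => sinTheta_nonneg _ _

end Run

variable {g C : ℝ}

/-- In all the modes but the first one the iterates are much closer to the truth than
in the worst mode. -/
theorem Run.mul_sinTheta_le (run : Run D Ω (tucker G A) κ) (hrk : ∀ t n, run.rk t n = r n)
    (hA : ∀ n, (A n)ᵀ * A n = 1) (hr : ∀ k, (unfold k G).rank = r k) (hg0 : 0 < g)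
    (hg : ∀ k, g ≤ singMin (unfold k G)) {i₀ : Fin N} (hi₀ : ∀ k, ¬ k < i₀)
    (hC : ∀ t n, sinTheta (kronExcept n (sweep (run.Q t) (run.A t) n) * (unfold n (run.core t))ᵀ)
      (kronExcept n A * (unfold n G)ᵀ) ≤ C * run.sinAngle A t) (t : ℕ) {k : Fin N} (hk : k ≠ i₀) :
    g * sinTheta (run.A t k) (A k) ≤ C * run.sinAngle A t * fro (tucker G A) := by
  -- At the update of the first mode no factor has been replaced yet.
  have h1 : sweep (run.Q t) (run.A t) i₀ = run.A t := by
    funext k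
    simp [sweep, hi₀ k]
  have h2 := hC t i₀
  rw [h1] at h2
  exact (mul_sinTheta_le_of_eq (funext (hrk t)) hA hk (hr k) hg0 (hg k) (run.core t) (run.A t)
    (run.A_orthonormal hrk t k)).trans (mul_le_mul_of_nonneg_right h2 (fro_nonneg _))

/-- The largest canonical angle contracts. -/
theorem Run.sinAngle_succ_le (run : Run D Ω (tucker G A) κ) (hrk : ∀ t n, run.rk t n = r n)
    (hA : ∀ n, (A n)ᵀ * A n = 1) (hr : ∀ k, (unfold k G).rank = r k) (hg0 : 0 < g)
    (hg : ∀ k, g ≤ singMin (unfold k G)) {i₀ i₁ : Fin N} (hi₀ : ∀ k, ¬ k < i₀) (hi : i₀ < i₁)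
    (hC : ∀ t n, sinTheta (kronExcept n (sweep (run.Q t) (run.A t) n) * (unfold n (run.core t))ᵀ)
      (kronExcept n A * (unfold n G)ᵀ) ≤ C * run.sinAngle A t) {q : ℝ} (hq0 : 0 ≤ q)
    (hq : C * fro (tucker G A) = q * g) (hq1 : q < 1) (t : ℕ) :
    run.sinAngle A (t + 1) ≤ q * run.sinAngle A t := by
  have : Nonempty (Fin N) := ⟨i₀⟩
  have hs := run.sinAngle_nonneg (A := A)
  -- The new first factor already takes part in the update of the next mode `i₁`, whose angle
  -- hypothesis refers to time `t`.
  have h0 : sinTheta (run.A (t + 1) i₀) (A i₀) ≤ q * run.sinAngle A t := by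
    rw [sinTheta_congr_left (run.A_orthonormal hrk (t + 1) i₀) (run.Q_orthonormal t i₀) (hA i₀)
      (run.A_succ_mul_transpose hrk t i₀)]
    have h1 : sweep (run.Q t) (run.A t) i₁ i₀ = run.Q t i₀ := by simp [sweep, hi]
    have h2 := mul_sinTheta_le_of_eq (funext (hrk t)) hA hi.ne (hr i₀) hg0 (hg i₀) (run.core t)
      (sweep (run.Q t) (run.A t) i₁) (by rw [h1]; exact run.Q_orthonormal t i₀)
    rw [h1] at h2
    have h3 := h2.trans (mul_le_mul_of_nonneg_right (hC t i₁) (fro_nonneg _))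
    refine le_of_mul_le_mul_left ?_ hg0
    linear_combination h3 + run.sinAngle A t * hq
  have h1 : ∀ k, k ≠ i₀ → sinTheta (run.A (t + 1) k) (A k) ≤ q * run.sinAngle A (t + 1) := by
    intro k hk
    have h2 := run.mul_sinTheta_le hrk hA hr hg0 hg hi₀ hC (t + 1) hk
    refine le_of_mul_le_mul_left ?_ hg0
    linear_combination h2 + run.sinAngle A (t + 1) * hq
  have h2 : run.sinAngle A (t + 1) ≤
      max (q * run.sinAngle A t) (q * run.sinAngle A (t + 1)) := by
    refine ciSup_le fun k => ?_
    by_cases hk : k = i₀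
    · subst hk; exact h0.trans (le_max_left _ _)
    · exact (h1 k hk).trans (le_max_right _ _)
  rcases le_max_iff.1 h2 with h3 | h3
  · exact h3
  -- If the maximum is `q` times the new angle itself, then `q < 1` makes that angle zero.
  · have h4 : run.sinAngle A (t + 1) ≤ 0 := by nlinarith [hs (t + 1)]
    exact h4.trans (mul_nonneg hq0 (hs t))

/-- Linear convergence on a well-sampled index set. -/
theorem Run.linear_convergence (run : Run D Ω (tucker G A) κ) (hrk : ∀ t n, run.rk t n = r n)
    (hA : ∀ n, (A n)ᵀ * A n = 1) (hr : ∀ k, (unfold k G).rank = r k) (hg0 : 0 < g)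
    (hg : ∀ k, g ≤ singMin (unfold k G)) {i₀ i₁ : Fin N} (hi₀ : ∀ k, ¬ k < i₀) (hi : i₀ < i₁)
    (hC : ∀ t n, sinTheta (kronExcept n (sweep (run.Q t) (run.A t) n) * (unfold n (run.core t))ᵀ)
      (kronExcept n A * (unfold n G)ᵀ) ≤ C * run.sinAngle A t) (hC0 : 0 < C)
    (hgT : g ≤ fro (tucker G A)) {γ Γ : ℝ} (hγ : 0 < γ) (hΓ : 0 < Γ)
    (hcap : ∀ t, γ * run.tau t ≤ minObsResidual Ω (tucker G A) (run.A t) ∧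
      minObsResidual Ω (tucker G A) (run.A t) ≤ Γ * run.tau t)
    {p m : ℝ} (hp0 : 0 < p) (hp1 : p ≤ 1)
    (hm : 12 * N * (fro (tucker G A) / g) * (C * fro (tucker G A) / g) ≤ m * √p)
    (hm7 : m < γ / (7 * Γ)) (hm7' : m ≤ 1 / 7)
    {A' : ∀ n, Matrix (Fin (I n)) (Fin (r n)) ℝ} (hA' : ∀ n, (A' n)ᵀ * A' n = 1)
    (hA'A : ∀ k, k ≠ i₀ → g * sinTheta (A' k) (A k) ≤ C * fro (tucker G A))
    (hΩ : WellSampled (kronAll (projExcept i₀ A')) p Ω) :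
    (∀ t, run.residual (t + 1) ≤ 7 * m * Γ / γ * run.residual t) ∧
      Filter.Tendsto run.estimate Filter.atTop (nhds (tucker G A)) := by
  set a := fro (tucker G A)
  set L := a / g
  set q := C * a / g
  set x := √p
  have hx0 : 0 < x := Real.sqrt_pos.2 hp0
  have hx1 : x ≤ 1 := Real.sqrt_le_one.2 hp1
  have hN : (1 : ℝ) ≤ N := by
    have : 0 < N := i₀.pos
    exact_mod_cast this
  have ha0 : 0 < a := hg0.trans_le hgT
  have hL : 1 ≤ L := (one_le_div hg0).2 hgT
  have hLa : L * g = a := div_mul_cancel₀ _ hg0.ne'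
  have hq0 : 0 ≤ q := by positivity
  have hqg : C * a = q * g := (div_mul_cancel₀ _ hg0.ne').symm
  have hNq0 : 0 ≤ N * q := mul_nonneg (by linarith) hq0
  -- `84 = 12 * 7`, from the bound on `m * √p` and `m ≤ 1/7`.
  have hNLq : N * q * L ≤ x / 84 := by
    have h1 : m * x ≤ 1 / 7 * x := mul_le_mul_of_nonneg_right hm7' hx0.le
    linarith
  have hNq : N * q ≤ x / 84 := (le_mul_of_one_le_right hNq0 hL).trans hNLq
  have hq1 : q < 1 := by
    have h1 : q ≤ N * q := le_mul_of_one_le_left hq0 hN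
    linarith
  have hqT : N * q * a ≤ x / 80 * g := by
    have h1 := mul_le_mul_of_nonneg_right hNLq hg0.le
    rw [mul_assoc, hLa] at h1
    nlinarith
  have hs := run.sinAngle_nonneg (A := A)
  have hsucc := run.sinAngle_succ_le hrk hA hr hg0 hg hi₀ hi hC hq0 hqg hq1
  have hcmp := fun t => residual_comparison (funext (hrk t)) (s := run.sinAngle A t) (q := q) hA
    (run.A_orthonormal hrk t) hA' (i₀ := i₀) hq0 hp0.le hp1 hr hg0 hg rfl
    (fun k hk => by
      have h2 := run.mul_sinTheta_le hrk hA hr hg0 hg hi₀ hC t hk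
      refine le_of_mul_le_mul_left ?_ hg0
      linear_combination h2 + run.sinAngle A t * hqg)
    (fun k hk => by
      refine le_of_mul_le_mul_left ?_ hg0
      linear_combination hA'A k hk + hqg)
    (hNq.trans (by linarith)) hqT hΩ
  have hres0 : ∀ t, 0 ≤ run.residual t := fun t => fro_nonneg _
  have hm0 : 0 ≤ m := by
    have h1 : 0 ≤ m * x := le_trans (by positivity) hm
    exact nonneg_of_mul_nonneg_left h1 hx0
  have hstep : ∀ t, run.residual (t + 1) ≤ 7 * m * Γ / γ * run.residual t := by
    intro t
    obtain ⟨hb, hlo, -⟩ := hcmp t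
    obtain ⟨hb', -, hhi'⟩ := hcmp (t + 1)
    have h1 : 2 / 5 * x * run.residual (t + 1) ≤ run.tau (t + 1) := (hb' (run.core (t + 1))).1
    have h2 : run.tau t ≤ 8 / 5 * x * run.residual t := (hb (run.core t)).2
    have h3 : 2 / 5 * x * (g * run.sinAngle A t) ≤ Γ * (8 / 5 * x * run.residual t) :=
      hlo.trans ((hcap t).2.trans (mul_le_mul_of_nonneg_left h2 hΓ.le))
    have h4 : γ * (2 / 5 * x * run.residual (t + 1)) ≤
        8 / 5 * x * (N * run.sinAngle A (t + 1) * a) :=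
      (mul_le_mul_of_nonneg_left h1 hγ.le).trans ((hcap (t + 1)).1.trans hhi')
    -- The factor `4` is the ratio of the sampling constants `8/5` and `2/5`; it occurs once at time
    -- `t` and once at `t + 1`.
    have h5 : g * run.sinAngle A t ≤ 4 * (Γ * run.residual t) := by
      refine le_of_mul_le_mul_left ?_ hx0
      linarith
    have h6 : γ * run.residual (t + 1) ≤ 4 * (N * run.sinAngle A (t + 1) * a) := by
      refine le_of_mul_le_mul_left ?_ hx0
      linarith
    have h7 : N * run.sinAngle A (t + 1) * a ≤ N * q * L * (g * run.sinAngle A t) := by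
      have h8 := mul_le_mul_of_nonneg_left (hsucc t) (by positivity : 0 ≤ N * a)
      calc N * run.sinAngle A (t + 1) * a = N * a * run.sinAngle A (t + 1) := by ring
        _ ≤ N * a * (q * run.sinAngle A t) := h8
        _ = N * q * L * (g * run.sinAngle A t) := by rw [← hLa]; ring
    have h9 : N * q * L ≤ m / 12 := by
      have h10 : m * x ≤ m := mul_le_of_le_one_right hm0 hx1
      linarith
    -- The resulting constant is `4 * 4 / 12 = 4/3`, below the claimed `7`.
    have h11 : N * q * L * (g * run.sinAngle A t) ≤ m / 12 * (4 * (Γ * run.residual t)) :=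
      mul_le_mul h9 h5 (mul_nonneg hg0.le (hs t)) (by positivity)
    have h12 : 0 ≤ m * (Γ * run.residual t) := mul_nonneg hm0 (mul_nonneg hΓ.le (hres0 t))
    rw [div_mul_eq_mul_div, le_div_iff₀ hγ]
    linarith
  refine ⟨hstep, tendsto_of_fro_sub_tendsto_zero ?_⟩
  set ϱ := 7 * m * Γ / γ
  have hϱ0 : 0 ≤ ϱ := by positivity
  have hϱ1 : ϱ < 1 := by
    rw [lt_div_iff₀ (by positivity)] at hm7
    rw [div_lt_one hγ]
    linarith
  have hgeom : ∀ t, run.residual t ≤ ϱ ^ t * run.residual 0 := by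
    intro t
    induction t with
    | zero => simp
    | succ t ih =>
      refine (hstep t).trans ((mul_le_mul_of_nonneg_left ih hϱ0).trans (le_of_eq ?_))
      rw [pow_succ]
      ring
  refine squeeze_zero hres0 hgeom ?_
  simpa using (tendsto_pow_atTop_nhds_zero_of_lt_one hϱ0 hϱ1).mul_const (run.residual 0)

end RunConvergence

/-! ### The constants -/

section ConstantBounds

variable {N : ℕ} {I r : Fin N → ℕ} {μ : Fin N → ℝ}

/-- Orthonormal columns with small row norms force the coherence bound to be at least `r / I`. -/
theorem le_coherence {a b : ℕ} {B : Matrix (Fin a) (Fin b) ℝ} (hB : Bᵀ * B = 1) {c : ℝ}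
    (hb : 0 < b) (h : ∀ i, √(∑ j, B i j ^ 2) ≤ √c) : 0 < c ∧ (b : ℝ) ≤ a * c := by
  have htr : ∑ i, ∑ j, B i j ^ 2 = b := by
    have h1 := congrArg Matrix.trace hB
    rw [Matrix.trace_one, Fintype.card_fin] at h1
    rw [← h1, Finset.sum_comm]
    simp [Matrix.trace, Matrix.mul_apply, sq]
  have hrow : ∀ i, 0 ≤ ∑ j, B i j ^ 2 := fun i => Finset.sum_nonneg fun _ _ => sq_nonneg _
  have hb' : (0 : ℝ) < b := Nat.cast_pos.2 hb
  have hc : 0 < c := by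
    by_contra! hc
    have h1 : ∀ i, ∑ j, B i j ^ 2 = 0 := by
      intro i
      have h2 := h i
      rw [Real.sqrt_eq_zero_of_nonpos hc] at h2
      have h3 := Real.sqrt_eq_zero'.1 (le_antisymm h2 (Real.sqrt_nonneg _))
      exact le_antisymm h3 (hrow i)
    simp only [h1, Finset.sum_const_zero] at htr
    linarith
  refine ⟨hc, ?_⟩
  rw [← htr]
  refine (Finset.sum_le_sum fun i _ => (Real.sqrt_le_sqrt_iff hc.le).1 (h i)).trans ?_
  simp

/-- Take a mode of smallest size: any other mode is at least as large and divides the product. -/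
theorem exists_le_coDim (hI : ∀ n, 0 < I n) {i₀ i₁ : Fin N} (hi : i₀ ≠ i₁) :
    ∃ n, (I n : ℝ) ≤ coDim I n := by
  have : Nonempty (Fin N) := ⟨i₀⟩
  obtain ⟨n, hn⟩ := Finite.exists_min I
  obtain ⟨k, hk⟩ : ∃ k, k ≠ n := by
    by_cases h : i₀ = n
    · exact ⟨i₁, fun h' => hi (h.trans h'.symm)⟩
    · exact ⟨i₀, h⟩
  refine ⟨n, ?_⟩
  rw [coDim, ← Nat.cast_prod, Nat.cast_le]
  exact (hn k).trans (Nat.le_of_dvd (Finset.prod_pos fun j _ => hI j)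
    (Finset.dvd_prod_of_mem I (Finset.mem_erase.2 ⟨hk, Finset.mem_univ k⟩)))

theorem growth_ge (N : ℕ) {s : ℝ} (hs : 0 ≤ s) : (N : ℝ) ≤ growth N s := by
  have h : ∑ _j ∈ Finset.range N, (1 : ℝ) ≤ growth N s :=
    Finset.sum_le_sum fun j _ => one_le_pow₀ (by linarith)
  simpa using h

theorem gMax_nonneg (T : Tensor I) : 0 ≤ gMax I T := Real.iSup_nonneg fun _ => specNorm_nonneg _

/-- The `C_2` term alone suffices. In a mode with `I n ≤ J n`, the coherence bound gives `C_2 ≥ C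
√(r n)`, while `‖T‖_F ≤ √(r n) g_max`. The factor `√(α / p)` cancels `√p` since `α ≥ 1`. -/
theorem sampleError_ge {T : Tensor I} {C gmin α p : ℝ} (hC : 0 < C) (hg : 0 < gmin) (hα : 1 ≤ α)
    (hp : 0 < p) (hI : ∀ n, 0 < I n) (hμ : ∀ n, (r n : ℝ) ≤ I n * (μ n * r n / I n))
    (hT : ∀ n, fro T ≤ √(r n) * specNorm (unfold n T)) {i₀ i₁ : Fin N} (hi : i₀ ≠ i₁) :
    6 * (C * fro T) ≤ sampleError I r μ C (gMax I T) gmin α p * √p := by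
  obtain ⟨n, hn⟩ := exists_le_coDim hI hi
  have hg0 := gMax_nonneg T
  have h1 : 0 ≤ const1 I r μ C (gMax I T) gmin :=
    mul_nonneg (mul_nonneg hC.le (div_nonneg hg0 hg.le))
      (Real.iSup_nonneg fun n => mul_nonneg (Real.sqrt_nonneg _)
        (Finset.prod_nonneg fun _ _ => Real.sqrt_nonneg _))
  have hIn : (0 : ℝ) < I n := Nat.cast_pos.2 (hI n)
  have h2 : C * √(r n) ≤ const2 I r μ C := by
    refine mul_le_mul_of_nonneg_left ?_ hC.le
    refine le_trans (Real.sqrt_le_sqrt ?_)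
      (le_ciSup (f := fun n => √(μ n * r n * coDim I n / I n)) (Set.finite_range _).bddAbove n)
    have h3 := hμ n
    rw [mul_div_cancel₀ _ hIn.ne'] at h3
    rw [le_div_iff₀ hIn]
    exact mul_le_mul h3 hn hIn.le ((Nat.cast_nonneg _).trans h3)
  have h3 : fro T ≤ √(r n) * gMax I T :=
    (hT n).trans (mul_le_mul_of_nonneg_left
      (le_ciSup (f := fun k => specNorm (unfold k T)) (Set.finite_range _).bddAbove n)
      (Real.sqrt_nonneg _))
  have h4 : 1 ≤ √(α / p) * √p := by
    rw [← Real.sqrt_mul (by positivity), div_mul_cancel₀ _ hp.ne', Real.one_le_sqrt]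
    exact hα
  have h5 : C * fro T ≤ gMax I T * (const1 I r μ C (gMax I T) gmin + const2 I r μ C) := by
    have h6 := mul_le_mul_of_nonneg_left h3 hC.le
    have h7 := mul_le_mul_of_nonneg_left h2 hg0
    have h8 := mul_nonneg hg0 h1
    linarith
  have h6 : 0 ≤ C * fro T := mul_nonneg hC.le (fro_nonneg _)
  rw [sampleError, mul_assoc]
  have h7 : 6 * (C * fro T) ≤
      6 * gMax I T * (const1 I r μ C (gMax I T) gmin + const2 I r μ C) := by linarith
  exact h7.trans (le_mul_of_one_le_right (by linarith) h4)

/-- The constant is `12 = 2 * 6`, with `3 / √2 ≥ 2` and `6` from the sampling error. The growth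
factor is at least `N`, and the denominator at most `g`. -/
theorem contractionQuantity_ge {a g κ ψ η s y x : ℝ} (ha : 0 ≤ a) (hg : 0 < g) (hκ : 0 ≤ κ)
    (hψ : 0 ≤ ψ) (hs : 0 ≤ s) (hx : 0 < x) (hy : 0 ≤ y) (hη : 6 * y ≤ η * x)
    (hd : 0 < contractionDenom g κ ψ η s) :
    12 * N * (a / g) * (y / g) ≤ contractionQuantity N a g κ ψ η s * x := by
  have hη0 : 0 ≤ η := nonneg_of_mul_nonneg_left (le_trans (by linarith) hη) hx
  have hdg : contractionDenom g κ ψ η s ≤ g := by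
    have h1 : 0 ≤ √2 * κ * ψ := by positivity
    have h2 := mul_nonneg hη0 hs
    rw [contractionDenom]
    linarith
  have h1 : 6 * (y / g) ≤ η / contractionDenom g κ ψ η s * x := by
    calc 6 * (y / g) = 6 * y / g := by ring
      _ ≤ η * x / g := div_le_div_of_nonneg_right hη hg.le
      _ ≤ η * x / contractionDenom g κ ψ η s :=
          div_le_div_of_nonneg_left (mul_nonneg hη0 hx.le) hd hdg
      _ = _ := by ring
  have h2 : 2 ≤ 3 / √2 := by
    rw [le_div_iff₀ (by positivity)]
    have : √2 ≤ 3 / 2 := by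
      rw [Real.sqrt_le_left (by norm_num)]
      norm_num
    linarith
  have h3 := growth_ge N hs
  have hag : 0 ≤ a / g := div_nonneg ha hg.le
  have hN : (0 : ℝ) ≤ N := Nat.cast_nonneg N
  calc 12 * N * (a / g) * (y / g) = 2 * (a / g) * N * (6 * (y / g)) := by ring
    _ ≤ 3 / √2 * (a / g) * growth N s * (η / contractionDenom g κ ψ η s * x) := by
        have h4 : 0 ≤ y / g := div_nonneg hy hg.le
        have h5 : 0 ≤ growth N s := hN.trans h3
        gcongr
    _ = _ := by rw [contractionQuantity]; ring

theorem one_le_prod_nat (hI : ∀ n, 0 < I n) : (1 : ℝ) ≤ ∏ k, (I k : ℝ) := by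
  rw [← Nat.cast_prod]
  exact_mod_cast Finset.prod_pos fun n _ => hI n

/-- For `N = 1` the product over the other modes is empty, so the threshold is at least `50/3` and
cannot meet `p ≤ 1/2`. -/
theorem two_le_of_pStar (hN : 0 < N) (hI : ∀ n, 0 < I n) (hp : 4 * pStar I r μ ≤ 1 / 2) :
    2 ≤ N := by
  by_contra! h
  obtain rfl : N = 1 := by omega
  have h1 : (⨆ n : Fin 1, ∏ k ∈ Finset.univ.erase n, μ k * r k / I k) = 1 := by
    simp
  have h2 : 0 ≤ Real.log (2 * ∏ k, (I k : ℝ)) :=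
    Real.log_nonneg (by linarith [one_le_prod_nat hI])
  rw [pStar, h1] at hp
  linarith

/-- The exponent exceeds `2 log (2 P) + 15`. One power of `2 P` absorbs the union of the two tails
and the dimension factor, the other one leaves `1 / P ≤ 1 / J`. -/
theorem failure_probability_le {P ρ p J : ℝ} (hP : 1 ≤ P) (hρ : 0 < ρ) (hJ : 0 < J) (hJP : J ≤ P)
    (hp : 4 * (10 / 3 * (Real.log (2 * P) + 5) * ρ) ≤ p) :
    2 * (P * Real.exp (-(p / (4 * ρ)))) ≤ 1 / (100 * J) := by
  have hl : 0 ≤ Real.log (2 * P) := Real.log_nonneg (by linarith)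
  have h1 : 2 * Real.log (2 * P) + 15 ≤ p / (4 * ρ) := by
    rw [le_div_iff₀ (by positivity)]
    have := mul_nonneg hl hρ.le
    nlinarith
  have h2 : Real.exp (-(p / (4 * ρ))) ≤ 1 / ((2 * P) ^ 2 * Real.exp 15) := by
    rw [Real.exp_neg, one_div]
    refine inv_anti₀ (by positivity) ?_
    calc (2 * P) ^ 2 * Real.exp 15 = Real.exp (2 * Real.log (2 * P) + 15) := by
          rw [Real.exp_add, two_mul (Real.log _), Real.exp_add, Real.exp_log (by linarith), sq]
      _ ≤ _ := Real.exp_le_exp.2 h1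
  have h3 : (50 : ℝ) ≤ Real.exp 15 := by
    have h4 : Real.exp 15 = Real.exp 1 ^ 15 := by rw [← Real.exp_nat_mul]; norm_num
    rw [h4]
    calc (50 : ℝ) ≤ 2 ^ 15 := by norm_num
      _ ≤ _ := pow_le_pow_left₀ (by norm_num) (by linarith [Real.exp_one_gt_d9]) 15
  calc 2 * (P * Real.exp (-(p / (4 * ρ)))) ≤ 2 * (P * (1 / ((2 * P) ^ 2 * Real.exp 15))) := by
        gcongr
    _ = 1 / (2 * P * Real.exp 15) := by field_simp
    _ ≤ 1 / (100 * J) := by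
        refine one_div_le_one_div_of_le (by positivity) ?_
        nlinarith

/-- The diagonal of `A k * (A k)ᵀ` consists of squared row norms; the free mode contributes the
factor one. -/
theorem kronAll_projExcept_diag_le {A : ∀ n, Matrix (Fin (I n)) (Fin (r n)) ℝ} {i₀ : Fin N}
    (hμ : ∀ k, 0 < μ k * r k / I k)
    (h : ∀ k i, √(∑ j, A k i j ^ 2) ≤ √(μ k * r k / I k)) (i : Index I) :
    kronAll (projExcept i₀ A) i i ≤ ∏ k ∈ Finset.univ.erase i₀, μ k * r k / I k := by
  rw [kronAll, ← Finset.mul_prod_erase _ _ (Finset.mem_univ i₀)]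
  have h1 : projExcept i₀ A i₀ (i i₀) (i i₀) = 1 := by simp [projExcept]
  have h2 : ∀ k ∈ Finset.univ.erase i₀,
      projExcept i₀ A k (i k) (i k) = ∑ j, A k (i k) j ^ 2 := by
    intro k hk
    rw [projExcept, if_neg (Finset.ne_of_mem_erase hk), Matrix.mul_apply]
    simp [sq]
  rw [h1, one_mul]
  refine Finset.prod_le_prod (fun k hk => ?_) fun k hk => ?_
  · rw [h2 k hk]
    exact Finset.sum_nonneg fun _ _ => sq_nonneg _
  · rw [h2 k hk]
    exact (Real.sqrt_le_sqrt_iff (hμ k).le).1 (h k (i k))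

theorem coDimMin_bounds (hI : ∀ n, 0 < I n) (i₀ : Fin N) :
    0 < coDimMin I ∧ coDimMin I ≤ ∏ k, (I k : ℝ) := by
  have : Nonempty (Fin N) := ⟨i₀⟩
  have hpos : ∀ n, 0 < coDim I n := fun n => Finset.prod_pos fun k _ => Nat.cast_pos.2 (hI k)
  constructor
  · obtain ⟨n, hn⟩ := exists_eq_ciInf_of_finite (f := coDim I)
    rw [coDimMin, ← hn]
    exact hpos n
  · refine (ciInf_le (Set.finite_range _).bddBelow i₀).trans ?_
    rw [← Finset.mul_prod_erase _ _ (Finset.mem_univ i₀)]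
    exact le_mul_of_one_le_left (hpos i₀).le (by exact_mod_cast hI i₀)

end ConstantBounds

/-- Transport of initial factors to the true sizes. -/
theorem exists_reference {N : ℕ} {I r d : Fin N → ℕ} (hd : d = r)
    (B : ∀ n, Matrix (Fin (I n)) (Fin (d n)) ℝ) {A : ∀ n, Matrix (Fin (I n)) (Fin (r n)) ℝ}
    (hB : ∀ n, (B n)ᵀ * B n = 1) {ν : Fin N → ℝ} (hν : ∀ k i, √(∑ j, B k i j ^ 2) ≤ √(ν k))
    {i₀ : Fin N} {g c : ℝ} (hA : ∀ k, k ≠ i₀ → g * sinTheta (B k) (A k) ≤ c) :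
    ∃ A' : ∀ n, Matrix (Fin (I n)) (Fin (r n)) ℝ, (∀ n, (A' n)ᵀ * A' n = 1) ∧
      (∀ k i, √(∑ j, A' k i j ^ 2) ≤ √(ν k)) ∧
      ∀ k, k ≠ i₀ → g * sinTheta (A' k) (A k) ≤ c := by
  subst hd
  exact ⟨B, hB, hν, hA⟩

end TensorCompletion

end

/-! ### The main theorem -/

open TensorCompletion
theorem theorem4p3
    {N K M : ℕ} (hN : 0 < N) (I r : Fin N → ℕ) (D : Diagram N K M)
    -- the tensor: a tensor network core of multilinear rank `r` in a Tucker wrapper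
    (T : Tensor I) (Astar : ∀ n, Matrix (Fin (I n)) (Fin (r n)) ℝ) (Bstar : D.Nodes r)
    (hAstar : ∀ n, (Astar n)ᵀ * Astar n = 1)
    (hrank : ∀ n, (unfold n (D.contract Bstar)).rank = r n)
    (hT : T = tucker (D.contract Bstar) Astar)
    -- the parameters
    (κtol : Fin N → ℝ) (hκtol : ∀ n, 1 ≤ κtol n) (μ : Fin N → ℝ)
    (γ Γ : ℝ) (hγ : 0 < γ) (hγΓ : γ ≤ Γ) (gmin : ℝ) (hgmin : 0 < gmin)
    (hgstar : ∀ n, gmin ≤ singMin (unfold n (D.contract Bstar)))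
    (C : ℝ) (hC : 0 < C) (α : ℝ) (hα : 1 ≤ α)
    (p : unitInterval) (hp : 4 * pStar I r μ ≤ p) (hp' : (p : ℝ) ≤ 1 / 2) :
    ENNReal.ofReal (1 - 1 / (100 * coDimMin I)) ≤
      ProbabilityTheory.setBernoulli (Set.univ : Set (Index I)) p
        {Ω | ∀ run : Run D Ω T κtol,
          -- incoherence of the iterates
          (∀ t n i, √(∑ j, run.A t n i j ^ 2) ≤ √(μ n * r n / I n)) →
          -- representation capacity of the network
          (∀ t, γ * run.tau t ≤ minObsResidual Ω T (run.A t) ∧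
            minObsResidual Ω T (run.A t) ≤ Γ * run.tau t) →
          -- correctly revealed ranks
          (∀ t n, run.rk t n = r n) →
          -- the constants `gmin` and `C`
          (∀ t n, gmin ≤ singMin (unfold n (run.core t))) →
          (∀ t n, sinTheta
              (kronExcept n (sweep (run.Q t) (run.A t) n) * (unfold n (run.core t))ᵀ)
              (kronExcept n Astar * (unfold n (D.contract Bstar))ᵀ) ≤
            C * run.sinAngle Astar t) →
          ∀ X₀ : Tensor (run.rk 0),
            (∀ X, obsResidual Ω T X₀ (run.A 0) ≤ obsResidual Ω T X (run.A 0)) →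
            ∀ κ ψ₀ η m : ℝ,
              κ = ⨆ k, condNumber (unfold k (D.contract Bstar)) →
              ψ₀ = fro (tucker X₀ (run.A 0) - T) →
              η = sampleError I r μ C (gMax I T) gmin α p →
              m = contractionQuantity N (fro T) gmin κ ψ₀ η (run.sinAngle Astar 0) →
              0 < contractionDenom gmin κ ψ₀ η (run.sinAngle Astar 0) →
              m < γ / (7 * Γ) →
              (∀ t, run.residual (t + 1) ≤ 7 * m * Γ / γ * run.residual t) ∧
                Filter.Tendsto run.estimate Filter.atTop (nhds T)} := by
  subst hT
  set G := D.contract Bstar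
  -- A zero size would make `singMin` vanish, against the positive `gmin`.
  have hr0 : ∀ n, 0 < r n := by
    intro n
    by_contra h
    have h1 : r n = 0 := by omega
    have h2 : singMin (unfold n G) = 0 := by
      rw [singMin, sing, LinearMap.singularValues_eq_zero_iff_le_finrank_range]
      refine (Submodule.finrank_le _).trans ?_
      rw [finrank_euclideanSpace_fin, h1]
      exact Nat.zero_le _
    linarith [hgstar n]
  have hI0 : ∀ n, 0 < I n := by
    intro n
    by_contra h
    have h1 : I n = 0 := by omega
    have h2 := congrArg Matrix.trace (hAstar n)
    rw [Matrix.trace_one, Fintype.card_fin, Matrix.trace_mul_comm] at h2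
    have h3 : IsEmpty (Fin (I n)) := by rw [h1]; infer_instance
    rw [Matrix.trace, Finset.univ_eq_empty, Finset.sum_empty] at h2
    exact absurd (Nat.cast_eq_zero.1 h2.symm) (hr0 n).ne'
  have hN2 := two_le_of_pStar hN hI0 (hp.trans hp')
  set i₀ : Fin N := ⟨0, hN⟩
  set i₁ : Fin N := ⟨1, hN2⟩
  have hi : i₀ < i₁ := Fin.mk_lt_mk.2 zero_lt_one
  have hi₀ : ∀ k, ¬ k < i₀ := fun k hk => absurd (Fin.lt_def.1 hk) (Nat.not_lt_zero _)
  have hΓ : 0 < Γ := hγ.trans_le hγΓ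
  -- What is required of reference factors; the condition mentions neither `Ω` nor a run.
  set good : (∀ n, Matrix (Fin (I n)) (Fin (r n)) ℝ) → Prop := fun A' =>
    (∀ n, (A' n)ᵀ * A' n = 1) ∧ (∀ k i, √(∑ j, A' k i j ^ 2) ≤ √(μ k * r k / I k)) ∧
      ∀ k, k ≠ i₀ → gmin * sinTheta (A' k) (Astar k) ≤ C * fro (tucker G Astar)
  have href : ∀ {Ω : Set (Index I)} (run : Run D Ω (tucker G Astar) κtol),
      (∀ t n i, √(∑ j, run.A t n i j ^ 2) ≤ √(μ n * r n / I n)) →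
      (∀ t n, run.rk t n = r n) →
      (∀ t n, sinTheta
        (kronExcept n (sweep (run.Q t) (run.A t) n) * (unfold n (run.core t))ᵀ)
        (kronExcept n Astar * (unfold n G)ᵀ) ≤ C * run.sinAngle Astar t) → ∃ A', good A' := by
    intro Ω run hinc hrk hCrun
    refine exists_reference (funext (hrk 0)) (run.A 0) (run.A_orthonormal hrk 0) (hinc 0)
      fun k hk => ?_
    have h1 := mul_sinTheta_le_of_eq (funext (hrk 0)) hAstar hk (hrank k) hgmin (hgstar k)
      (run.core 0) (run.A 0) (run.A_orthonormal hrk 0 k)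
    have h2 : run.sinAngle Astar 0 ≤ 1 := by
      have : Nonempty (Fin N) := ⟨i₀⟩
      refine ciSup_le fun j => ?_
      have hone : ∀ {d : ℕ} (hd : d = r j) (B : Matrix (Fin (I j)) (Fin d) ℝ),
          Bᵀ * B = 1 → sinTheta B (Astar j) ≤ 1 := by
        intro d hd B hB
        subst hd
        exact sinTheta_le_one hB (hAstar j)
      exact hone (hrk 0 j) (run.A 0 j) (run.A_orthonormal hrk 0 j)
    have h3 := run.mul_sinTheta_le hrk hAstar hrank hgmin hgstar hi₀ hCrun 0 hk
    refine h3.trans (mul_le_mul_of_nonneg_right ?_ (fro_nonneg _))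
    exact mul_le_of_le_one_right hC.le h2
  -- The reference is fixed before `Ω` is drawn. If none exists, no run for any `Ω` meets the
  -- hypotheses, and the event is everything.
  by_cases hgood : ∃ A', good A'
  swap
  · rw [show {Ω : Set (Index I) | _} = Set.univ from Set.eq_univ_of_forall fun Ω run hinc _ hrk _
      hCrun => absurd (href run hinc hrk hCrun) hgood, MeasureTheory.measure_univ]
    rw [← ENNReal.ofReal_one]
    refine ENNReal.ofReal_le_ofReal ?_
    have := (coDimMin_bounds hI0 i₀).1
    have h1 : 0 ≤ 1 / (100 * coDimMin I) := by positivity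
    linarith
  obtain ⟨A', hA', hA'inc, hA'A⟩ := hgood
  have hμ : ∀ k, 0 < μ k * r k / I k := fun k => (le_coherence (hA' k) (hr0 k) (hA'inc k)).1
  have hμ' : ∀ k, (r k : ℝ) ≤ I k * (μ k * r k / I k) :=
    fun k => (le_coherence (hA' k) (hr0 k) (hA'inc k)).2
  set ρ := ∏ k ∈ Finset.univ.erase i₀, μ k * r k / I k
  have hρ : 0 < ρ := Finset.prod_pos fun k _ => hμ k
  have hP := one_le_prod_nat hI0
  have hlog : 0 ≤ Real.log (2 * ∏ k, (I k : ℝ)) := Real.log_nonneg (by linarith)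
  -- Only the product omitting the first mode is needed; the threshold contains the maximum over all
  -- modes.
  have hpρ : 4 * (10 / 3 * (Real.log (2 * ∏ k, (I k : ℝ)) + 5) * ρ) ≤ p := by
    refine le_trans ?_ hp
    rw [pStar]
    have h1 : ρ ≤ ⨆ n, ∏ k ∈ Finset.univ.erase n, μ k * r k / I k :=
      le_ciSup (f := fun n => ∏ k ∈ Finset.univ.erase n, μ k * r k / I k)
        (Set.finite_range _).bddAbove i₀
    gcongr
  have hp0 : (0 : ℝ) < p := lt_of_lt_of_le (by positivity) hpρ
  have hJ := coDimMin_bounds hI0 i₀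
  have hprob := setBernoulli_wellSampled_ge
    (kronAll_transpose (projExcept_transpose i₀ A')) (kronAll_mul_self (projExcept_mul_self hA' i₀))
    hρ (kronAll_projExcept_diag_le hμ hA'inc) p
  refine le_trans (ENNReal.ofReal_le_ofReal ?_) (hprob.trans (MeasureTheory.measure_mono ?_))
  · have h1 := failure_probability_le hP hρ hJ.1 hJ.2 hpρ
    have h2 : (Fintype.card (Index I) : ℝ) = ∏ k, (I k : ℝ) := by
      rw [Fintype.card_pi]
      simp
    rw [h2]
    linarith
  intro Ω hΩ run hinc hcap hrk _ hCrun X₀ _ κ ψ₀ η m hκ hψ hη hm hden hmlt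
  have hκ0 : 0 ≤ κ := by
    rw [hκ]
    exact Real.iSup_nonneg fun k => div_nonneg (LinearMap.singularValues_nonneg _ _)
      (LinearMap.singularValues_nonneg _ _)
  have hη6 := sampleError_ge (T := tucker G Astar) hC hgmin hα hp0 hI0 hμ'
    (fro_tucker_le_sqrt_mul_specNorm hAstar) hi.ne
  rw [← hη] at hη6
  have hmge := contractionQuantity_ge (N := N) (fro_nonneg (tucker G Astar)) hgmin hκ0
    (hψ ▸ fro_nonneg _) (run.sinAngle_nonneg 0) (Real.sqrt_pos.2 hp0)
    (mul_nonneg hC.le (fro_nonneg _)) hη6 hden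
  rw [← hm] at hmge
  -- Because `γ ≤ Γ`.
  have hm7 : m ≤ 1 / 7 := by
    refine hmlt.le.trans ?_
    rw [div_le_div_iff₀ (by positivity) (by norm_num)]
    linarith
  exact run.linear_convergence hrk hAstar hrank hgmin hgstar hi₀ hi hCrun hC
    (le_fro_tucker hAstar i₀ (hr0 i₀) (hrank i₀) hgmin (hgstar i₀)) hγ hΓ hcap hp0
    (hp'.trans (by norm_num)) hmge hmlt hm7 hA' hA'A hΩ
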